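/- Let $k$ be a field of characteristic $0$, $V$ a $k$-vector space of finite dimension $r$ with dual $V^*$, and $\Delta\subset V$ a finite set of nonzero vectors spanning $V$. Identify the symmetric algebra $S(V)$ with the ring of polynomial functions on $V^*$, let $\hat S(V)$ be its completion (formal power series), and put $R_\Delta=\Delta^{-1}S(V)$, $\hat R_\Delta=\Delta^{-1}\hat S(V)$. Call $y\in V^*$ regular if $\langle\alpha,y\rangle\ne0$ for all $\alpha\in\Delta$; elements of $R_\Delta$ are functions on the set of regular elements. Let - $G_\Delta\subset R_\Delta$ be the span of the $\prod_{\alpha\in\kappa}\alpha^{-n_\alpha}$ with $\kappa\subset\Delta$ generating $V$ and all $n_\alpha\geq1$; - $NG_\Delta\subset R_\Delta$ be the span of the $\psi\prod_{\alpha\in\kappa}\alpha^{-n_\alpha}$ with $\psi\in S(V)$, $\kappa\subset\Delta$ not generating $V$, and $n_\alpha\geq0$; - $S_\Delta$ be the span of the $\prod_{\alpha\in\sigma}\alpha^{-1}$ with $\sigma\subset\Delta$ a basis of $V$; it is the part of $G_\Delta$ of degree $-r$. Then $R_\Delta=G_\Delta\oplus NG_\Delta$. Let $Princ_\Delta:\hat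 R_\Delta\to G_\Delta$ be the Taylor expansion $\hat R_\Delta\to R_\Delta[\leq -r]$ (keeping the homogeneous components of degree $\le -r$) followed by the projection onto $G_\Delta$ along $NG_\Delta$, and let $Res_\Delta:\hat R_\Delta\to S_\Delta$ be $Princ_\Delta$ followed by the projection of $G_\Delta$ onto its degree $-r$ part $S_\Delta$. For $y\in V^*$ regular and $\psi\in R_\Delta$, let $C(y)\psi\in\hat S(V)$ be the Taylor series at $z=0$ of $z\mapsto\psi(y-z)$, and for $\phi\in\hat R_\Delta$ let $m(\phi)$ denote multiplication by $\phi$. (1) For every $\phi\in\hat R_\Delta$ and every regular $y\in V^*$, $$(Princ_\Delta\,\phi)(y)=\mathrm{Tr}_{S_\Delta}\bigl(Res_\Delta\circ m(\phi)\circ C(y)\bigr),$$ that is, $(Princ_\Delta\,\phi)(y)$ is the trace of the endomorphism $\psi\mapsto Res_\Delta(\phi(z)\psi(y-z))$ of $S_\Delta$. (2) Let $\phi\in\hat R_\Delta$, let $(\phi_b)_{b\in B}$ be any basis of $S_\Delta$, and let $(\phi^b)_{b\in B}$ be the dual basis. For $b\in B$ the function on $V$ $$D^b(\phi)(h):=\langle\phi^b,\,Res_\Delta(e^{-h}\phi)\rangle,\qquad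 h\in V,$$ is polynomial, where $e^{-h}=\sum_n(-h)^n/n!\in\hat S(V)$. Thus it is an element of $S(V^*)$, and so defines a differential operator $D^b(\phi)$ with constant coefficients on $V^*$ ($w\in V^*$ acting as the derivative $\partial(w)$ in direction $w$), and $$Princ_\Delta(\phi)=\sum_{b\in B}D^b(\phi)\cdot\phi_b .$$ -/

import Mathlib

noncomputable section

namespace JK

variable {k : Type*} [Field k] {V : Type*} [AddCommGroup V] [Module k V] {r : ℕ}

/-- The linear form on the dual `V*` defined by `α : V`, written as a polynomial in the coordinates
of `V*` attached to the basis `b` of `V`. The symmetric algebra `S(V)`, i.e. the ring of polynomial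
functions on `V*`, is `MvPolynomial (Fin r) k` (the variable `X i` is the function
`z ↦ ⟨b i, z⟩`), and its completion `Ŝ(V)` is `MvPowerSeries (Fin r) k`. -/
def linForm (b : Module.Basis (Fin r) k V) (α : V) : MvPolynomial (Fin r) k :=
  ∑ i, MvPolynomial.C (b.repr α i) * MvPolynomial.X i

/-- The multiplicative set of products of linear forms `α ∈ Δ`. -/
def denoms (b : Module.Basis (Fin r) k V) (Δ : Finset V) : Submonoid (MvPolynomial (Fin r) k) :=
  Submonoid.closure (linForm b '' (Δ : Set V))

/-- The same multiplicative set in the ring of formal power series. -/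
def denomsHat (b : Module.Basis (Fin r) k V) (Δ : Finset V) :
    Submonoid (MvPowerSeries (Fin r) k) :=
  (denoms b Δ).map MvPolynomial.coeToMvPowerSeries.ringHom

theorem isUnit_of_mem_denoms {A : Type*} [CommRing A] [Algebra k A]
    (b : Module.Basis (Fin r) k V) (Δ : Finset V) (f : MvPolynomial (Fin r) k →ₐ[k] A)
    (hf : ∀ α ∈ Δ, IsUnit (f (linForm b α))) (d : denoms b Δ) : IsUnit (f d) := by
  obtain ⟨d, hd⟩ := d
  change IsUnit (f d)
  induction hd using Submonoid.closure_induction with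
  | mem x hx => obtain ⟨α, hα, rfl⟩ := hx; exact hf α hα
  | one => rw [map_one]; exact isUnit_one
  | mul x y _ _ hx hy => rw [map_mul]; exact hx.mul hy

/-- `R_Δ = Δ⁻¹ S(V)`. -/
abbrev RDelta (b : Module.Basis (Fin r) k V) (Δ : Finset V) := Localization (denoms b Δ)

/-- `R̂_Δ = Δ⁻¹ Ŝ(V)`. -/
abbrev RDeltaHat (b : Module.Basis (Fin r) k V) (Δ : Finset V) := Localization (denomsHat b Δ)

/-- The natural map `S(V) → R̂_Δ`. -/
def polyToHat (b : Module.Basis (Fin r) k V) (Δ : Finset V) :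
    MvPolynomial (Fin r) k →ₐ[k] RDeltaHat b Δ :=
  (IsScalarTower.toAlgHom k (MvPowerSeries (Fin r) k) (RDeltaHat b Δ)).comp
    (MvPolynomial.coeToMvPowerSeries.algHom k)

theorem polyToHat_apply (b : Module.Basis (Fin r) k V) (Δ : Finset V)
    (p : MvPolynomial (Fin r) k) :
    polyToHat b Δ p = algebraMap _ _ (p : MvPowerSeries (Fin r) k) := by
  simp [polyToHat]

/-- The natural map `R_Δ → R̂_Δ`. -/
def toHat (b : Module.Basis (Fin r) k V) (Δ : Finset V) : RDelta b Δ →ₐ[k] RDeltaHat b Δ :=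
  IsLocalization.liftAlgHom (M := denoms b Δ) (f := polyToHat b Δ) fun d => by
    rw [polyToHat_apply]
    exact IsLocalization.map_units (RDeltaHat b Δ) (⟨_, d, d.2, rfl⟩ : denomsHat b Δ)

theorem toHat_algebraMap (b : Module.Basis (Fin r) k V) (Δ : Finset V)
    (p : MvPolynomial (Fin r) k) :
    toHat b Δ (algebraMap _ _ p) = algebraMap _ _ (p : MvPowerSeries (Fin r) k) := by
  rw [← polyToHat_apply, toHat, IsLocalization.coe_liftAlgHom, IsLocalization.lift_eq]
  rfl

/-- `α ∈ Δ` as an allowed denominator. -/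
def den (b : Module.Basis (Fin r) k V) (Δ : Finset V) (α : Δ) : denoms b Δ :=
  ⟨linForm b α, Submonoid.subset_closure ⟨α, α.2, rfl⟩⟩

/-- A subset `κ` of `Δ` is generating if it spans `V`. -/
def Generating (k : Type*) [Field k] {V : Type*} [AddCommGroup V] [Module k V] {Δ : Finset V}
    (κ : Finset Δ) : Prop :=
  Submodule.span k ((fun α : Δ => (α : V)) '' (κ : Set Δ)) = ⊤

/-- A subset `σ` of `Δ` is a basis of `Δ` if its elements form a basis of `V`. -/
def IsBasis (k : Type*) [Field k] {V : Type*} [AddCommGroup V] [Module k V] {Δ : Finset V}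
    (σ : Finset Δ) : Prop :=
  LinearIndepOn k (fun α : Δ => (α : V)) (σ : Set Δ) ∧ Generating k σ

/-- `G_Δ`: the span of the `1 / ∏_{α ∈ κ} α ^ n_α` with `κ` generating and all `n_α > 0`. -/
def G (b : Module.Basis (Fin r) k V) (Δ : Finset V) : Submodule k (RDelta b Δ) :=
  Submodule.span k {x | ∃ (κ : Finset Δ) (n : Δ → ℕ), Generating k κ ∧ (∀ α ∈ κ, 0 < n α) ∧
    x = Localization.mk 1 (∏ α ∈ κ, den b Δ α ^ n α)}

/-- `NG_Δ`: the span of the `ψ / ∏_{α ∈ κ} α ^ n_α` with `ψ ∈ S(V)` and `κ` not generating. -/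
def NG (b : Module.Basis (Fin r) k V) (Δ : Finset V) : Submodule k (RDelta b Δ) :=
  Submodule.span k {x | ∃ (κ : Finset Δ) (n : Δ → ℕ) (ψ : MvPolynomial (Fin r) k),
    ¬ Generating k κ ∧ x = Localization.mk ψ (∏ α ∈ κ, den b Δ α ^ n α)}

/-- `S_Δ`: the span of the `φ_σ = 1 / ∏_{α ∈ σ} α` with `σ` a basis of `Δ`. -/
def S (b : Module.Basis (Fin r) k V) (Δ : Finset V) : Submodule k (RDelta b Δ) :=
  Submodule.span k {x | ∃ σ : Finset Δ, IsBasis k σ ∧ x = Localization.mk 1 (∏ α ∈ σ, den b Δ α)}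


/-- `S_Δ` is finite dimensional, so that traces of its endomorphisms make sense. -/
instance (b : Module.Basis (Fin r) k V) (Δ : Finset V) : Module.Finite k (S b Δ) := by
  apply Module.Finite.span_of_finite
  refine (Set.finite_range
    (fun σ : Finset Δ => (Localization.mk 1 (∏ α ∈ σ, den b Δ α) : RDelta b Δ))).subset ?_
  rintro x ⟨σ, -, rfl⟩
  exact ⟨σ, rfl⟩

/-! ### Taylor expansion -/

theorem exists_rep (b : Module.Basis (Fin r) k V) (Δ : Finset V) (φ : RDeltaHat b Δ) :
    ∃ p : MvPowerSeries (Fin r) k × denoms b Δ,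
      φ * algebraMap _ _ ((p.2 : MvPolynomial (Fin r) k) : MvPowerSeries (Fin r) k)
        = algebraMap _ _ p.1 := by
  obtain ⟨⟨f, ⟨_, d, hd, rfl⟩⟩, h⟩ := IsLocalization.surj (denomsHat b Δ) φ
  exact ⟨(f, ⟨d, hd⟩), h⟩

/-- The value of the Taylor expansion on `φ = f / d`: truncate `f` at total degree `K + deg d`,
and divide by `d`. -/
def taylorFun (b : Module.Basis (Fin r) k V) (Δ : Finset V) (K : ℤ) (φ : RDeltaHat b Δ) : RDelta b Δ :=
  let f := (exists_rep b Δ φ).choose.1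
  let d := (exists_rep b Δ φ).choose.2
  Localization.mk (MvPowerSeries.truncTotal
    (K + ((d : MvPolynomial (Fin r) k).totalDegree : ℤ) + 1).toNat f) d

theorem truncTotal_mul (d : MvPolynomial (Fin r) k) (n : ℕ) (hd : d.IsHomogeneous n)
    (N : ℤ) (f : MvPowerSeries (Fin r) k) :
    MvPowerSeries.truncTotal (N + n).toNat ((d : MvPowerSeries (Fin r) k) * f)
      = d * MvPowerSeries.truncTotal N.toNat f := by
  ext m
  rw [MvPowerSeries.coeff_truncTotal_eq_ite, MvPolynomial.coeff_mul, MvPowerSeries.coeff_mul]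
  simp only [MvPolynomial.coeff_coe, MvPowerSeries.coeff_truncTotal_eq_ite]
  have key : ∀ x ∈ Finset.HasAntidiagonal.antidiagonal m, MvPolynomial.coeff x.1 d ≠ 0 →
      (m.degree < (N + n).toNat ↔ x.2.degree < N.toNat) := by
    intro x hx h0
    have h1 : x.1.degree = n := by
      by_contra hne
      exact h0 (hd.coeff_eq_zero hne)
    have h2 : m.degree = n + x.2.degree := by
      rw [← Finset.HasAntidiagonal.mem_antidiagonal.1 hx, map_add, h1]
    omega
  split_ifs with hm
  · refine Finset.sum_congr rfl fun x hx => ?_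
    by_cases h0 : MvPolynomial.coeff x.1 d = 0
    · simp [h0]
    · rw [if_pos ((key x hx h0).1 hm)]
  · refine (Finset.sum_eq_zero fun x hx => ?_).symm
    by_cases h0 : MvPolynomial.coeff x.1 d = 0
    · simp [h0]
    · rw [if_neg fun h => hm ((key x hx h0).2 h), mul_zero]

theorem linForm_isHomogeneous (b : Module.Basis (Fin r) k V) (α : V) :
    (linForm b α).IsHomogeneous 1 := by
  unfold linForm
  refine MvPolynomial.IsHomogeneous.sum _ _ _ fun i _ => ?_
  simpa using (MvPolynomial.isHomogeneous_C (Fin r) (b.repr α i)).mul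
    (MvPolynomial.isHomogeneous_X k i)

theorem denoms_isHomogeneous (b : Module.Basis (Fin r) k V) (Δ : Finset V) (d : denoms b Δ) :
    (d : MvPolynomial (Fin r) k).IsHomogeneous (d : MvPolynomial (Fin r) k).totalDegree := by
  have h : ∃ n, (d : MvPolynomial (Fin r) k).IsHomogeneous n := by
    obtain ⟨d, hd⟩ := d
    change ∃ n, d.IsHomogeneous n
    induction hd using Submonoid.closure_induction with
    | mem x hx => obtain ⟨α, hα, rfl⟩ := hx; exact ⟨1, linForm_isHomogeneous b α⟩
    | one => exact ⟨0, MvPolynomial.isHomogeneous_one _ _⟩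
    | mul x y _ _ hx hy =>
      obtain ⟨m, hm⟩ := hx
      obtain ⟨n, hn⟩ := hy
      exact ⟨_, hm.mul hn⟩
  obtain ⟨n, hn⟩ := h
  by_cases h0 : (d : MvPolynomial (Fin r) k) = 0
  · rw [h0]; exact MvPolynomial.isHomogeneous_zero _ _ _
  · rwa [hn.totalDegree h0]

theorem subsingleton_of_zero_mem (b : Module.Basis (Fin r) k V) (Δ : Finset V) (d : denoms b Δ)
    (hd : (d : MvPolynomial (Fin r) k) = 0) : Subsingleton (RDelta b Δ) := by
  apply IsLocalization.subsingleton (M := denoms b Δ)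
  rw [← hd]; exact d.2

theorem coe_truncTotal_mul (b : Module.Basis (Fin r) k V) (Δ : Finset V) (d e : denoms b Δ)
    (K : ℤ) (f : MvPowerSeries (Fin r) k) :
    (Localization.mk (MvPowerSeries.truncTotal
      (K + (((d * e : denoms b Δ) : MvPolynomial (Fin r) k).totalDegree : ℤ) + 1).toNat
        (((d : MvPolynomial (Fin r) k) : MvPowerSeries (Fin r) k) * f)) (d * e) : RDelta b Δ)
      = Localization.mk (MvPowerSeries.truncTotal
        (K + ((e : MvPolynomial (Fin r) k).totalDegree : ℤ) + 1).toNat f) e := by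
  by_cases h0 : ((d * e : denoms b Δ) : MvPolynomial (Fin r) k) = 0
  · have := subsingleton_of_zero_mem b Δ _ h0
    exact Subsingleton.elim _ _
  · have h1 : (d : MvPolynomial (Fin r) k) ≠ 0 := fun h => h0 (by simp [h])
    have h2 : (e : MvPolynomial (Fin r) k) ≠ 0 := fun h => h0 (by simp [h])
    have h3 : ((d * e : denoms b Δ) : MvPolynomial (Fin r) k).totalDegree
        = (d : MvPolynomial (Fin r) k).totalDegree + (e : MvPolynomial (Fin r) k).totalDegree := by
      rw [Submonoid.coe_mul, MvPolynomial.totalDegree_mul_of_isDomain h1 h2]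
    rw [h3, show K + (((d : MvPolynomial (Fin r) k).totalDegree
        + (e : MvPolynomial (Fin r) k).totalDegree : ℕ) : ℤ) + 1
        = (K + ((e : MvPolynomial (Fin r) k).totalDegree : ℤ) + 1)
          + ((d : MvPolynomial (Fin r) k).totalDegree : ℤ) by push_cast; ring,
      truncTotal_mul _ _ (denoms_isHomogeneous b Δ d), Localization.mk_eq_mk_iff,
      Localization.r_iff_exists]
    exact ⟨1, by simp; ring⟩

theorem taylorFun_eq (b : Module.Basis (Fin r) k V) (Δ : Finset V) (K : ℤ) (φ : RDeltaHat b Δ)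
    (f : MvPowerSeries (Fin r) k) (d : denoms b Δ)
    (h : φ * algebraMap _ _ ((d : MvPolynomial (Fin r) k) : MvPowerSeries (Fin r) k)
        = algebraMap _ _ f) :
    taylorFun b Δ K φ = Localization.mk (MvPowerSeries.truncTotal
      (K + ((d : MvPolynomial (Fin r) k).totalDegree : ℤ) + 1).toNat f) d := by
  unfold taylorFun
  have h' := (exists_rep b Δ φ).choose_spec
  generalize (exists_rep b Δ φ).choose = p at h'
  obtain ⟨f', d'⟩ := p
  simp only at h' ⊢
  have h1 : algebraMap (MvPowerSeries (Fin r) k) (RDeltaHat b Δ)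
      (((d : MvPolynomial (Fin r) k) : MvPowerSeries (Fin r) k) * f')
      = algebraMap _ _ (((d' : MvPolynomial (Fin r) k) : MvPowerSeries (Fin r) k) * f) := by
    rw [map_mul, map_mul, ← h, ← h']; ring
  obtain ⟨⟨_, c, hc, rfl⟩, h2⟩ := (IsLocalization.eq_iff_exists (denomsHat b Δ) _).1 h1
  rw [← coe_truncTotal_mul b Δ d d', ← coe_truncTotal_mul b Δ (⟨c, hc⟩ : denoms b Δ) (d * d'),
    ← coe_truncTotal_mul b Δ d' d, ← coe_truncTotal_mul b Δ (⟨c, hc⟩ : denoms b Δ) (d' * d),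
    mul_comm d' d]
  have h3 : (c : MvPowerSeries (Fin r) k)
      * (((d : MvPolynomial (Fin r) k) : MvPowerSeries (Fin r) k) * f')
      = (c : MvPowerSeries (Fin r) k)
      * (((d' : MvPolynomial (Fin r) k) : MvPowerSeries (Fin r) k) * f) := h2
  simp only [h3]

/-- The Taylor expansion `Taylor_{[≤ K]} : R̂_Δ → ⨁_{j ≤ K} R_Δ[j]`, sending `f / d`
(with `d` a product of elements of `Δ`) to `∑_{m ≤ K + deg d} f_m / d`, where `f_m` is the
homogeneous part of degree `m` of the power series `f`. -/
def taylor (b : Module.Basis (Fin r) k V) (Δ : Finset V) (K : ℤ) : RDeltaHat b Δ →ₗ[k] RDelta b Δ where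
  toFun := taylorFun b Δ K
  map_add' φ ψ := by
    obtain ⟨⟨f, d⟩, hf⟩ := exists_rep b Δ φ
    obtain ⟨⟨g, e⟩, hg⟩ := exists_rep b Δ ψ
    simp only at hf hg
    have h : (φ + ψ) * algebraMap _ _
        (((d * e : denoms b Δ) : MvPolynomial (Fin r) k) : MvPowerSeries (Fin r) k)
        = algebraMap _ _ (((e : MvPolynomial (Fin r) k) : MvPowerSeries (Fin r) k) * f
          + ((d : MvPolynomial (Fin r) k) : MvPowerSeries (Fin r) k) * g) := by
      rw [Submonoid.coe_mul, MvPolynomial.coe_mul, map_mul, map_add, map_mul, map_mul, ← hf, ← hg]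
      ring
    rw [taylorFun_eq b Δ K _ _ _ hf, taylorFun_eq b Δ K _ _ _ hg, taylorFun_eq b Δ K _ _ _ h,
      map_add, ← Localization.add_mk_self, coe_truncTotal_mul, mul_comm d e, coe_truncTotal_mul]
  map_smul' c φ := by
    obtain ⟨⟨f, d⟩, hf⟩ := exists_rep b Δ φ
    simp only at hf
    have h : (c • φ) * algebraMap _ _
        ((d : MvPolynomial (Fin r) k) : MvPowerSeries (Fin r) k) = algebraMap _ _ (c • f) := by
      rw [smul_mul_assoc, hf]
      exact (map_smul (IsScalarTower.toAlgHom k (MvPowerSeries (Fin r) k) (RDeltaHat b Δ))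
        c f).symm
    rw [taylorFun_eq b Δ K _ _ _ hf, taylorFun_eq b Δ K _ _ _ h, map_smul, RingHom.id_apply,
      Localization.smul_mk]

/-- The projection of `R_Δ` onto its part of degree `j`. -/
def degPart (b : Module.Basis (Fin r) k V) (Δ : Finset V) (j : ℤ) : RDelta b Δ →ₗ[k] RDelta b Δ :=
  (taylor b Δ j - taylor b Δ (j - 1)) ∘ₗ (toHat b Δ).toLinearMap

theorem degPart_mem (b : Module.Basis (Fin r) k V) (Δ : Finset V) (φ : RDelta b Δ)
    (hφ : φ ∈ G b Δ) : degPart b Δ (-r) φ ∈ S b Δ := by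
  unfold G at hφ
  induction hφ using Submodule.span_induction with
  | zero => rw [map_zero]; exact zero_mem _
  | add x y _ _ hx hy => rw [map_add]; exact add_mem hx hy
  | smul c x _ hx => rw [map_smul]; exact Submodule.smul_mem _ c hx
  | mem x hx =>
    obtain ⟨κ, n, hκ, hn, rfl⟩ := hx
    set D : denoms b Δ := ∏ α ∈ κ, den b Δ α ^ n α with hD
    by_cases h0 : (D : MvPolynomial (Fin r) k) = 0
    · have := subsingleton_of_zero_mem b Δ D h0
      rw [Subsingleton.elim (degPart b Δ (-r) _) 0]
      exact zero_mem _
    have hrep : toHat b Δ (Localization.mk 1 D)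
        * algebraMap _ _ ((D : MvPolynomial (Fin r) k) : MvPowerSeries (Fin r) k)
        = algebraMap (MvPowerSeries (Fin r) k) (RDeltaHat b Δ) 1 := by
      rw [← toHat_algebraMap, ← map_mul, Localization.mk_eq_mk', IsLocalization.mk'_spec, map_one,
        map_one, map_one]
    have hpart : ∀ j : ℤ, taylor b Δ j (toHat b Δ (Localization.mk 1 D))
        = Localization.mk (MvPowerSeries.truncTotal
          (j + ((D : MvPolynomial (Fin r) k).totalDegree : ℤ) + 1).toNat 1) D :=
      fun j => taylorFun_eq b Δ j _ _ _ hrep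
    have hdeg : (D : MvPolynomial (Fin r) k).totalDegree = ∑ α ∈ κ, n α := by
      refine MvPolynomial.IsHomogeneous.totalDegree ?_ h0
      rw [hD, Submonoid.coe_finsetProd]
      refine MvPolynomial.IsHomogeneous.prod _ _ _ fun α _ => ?_
      simpa [den] using (linForm_isHomogeneous b (α : V)).pow (n α)
    have hfin : Module.finrank k V = r := by simpa using Module.finrank_eq_card_basis b
    have hcard : r ≤ κ.card := by
      have h := finrank_span_finset_le_card (R := k) (κ.map (Function.Embedding.subtype _))
      rw [Finset.card_map] at h
      have h2 : Submodule.span k ((κ.map (Function.Embedding.subtype (· ∈ Δ)) : Finset V) : Set V)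
          = ⊤ := by
        rw [← hκ, Finset.coe_map]; rfl
      rw [Set.finrank, h2, finrank_top, hfin] at h
      exact h
    have hle : κ.card ≤ ∑ α ∈ κ, n α := by
      rw [Finset.card_eq_sum_ones]
      exact Finset.sum_le_sum fun α hα => hn α hα
    simp only [degPart, LinearMap.comp_apply, LinearMap.sub_apply, AlgHom.toLinearMap_apply, hpart,
      hdeg]
    by_cases heq : ∑ α ∈ κ, n α = r
    · have e1 : (-(r : ℤ) + ((∑ α ∈ κ, n α : ℕ) : ℤ) + 1).toNat = 1 := by omega
      have e2 : (-(r : ℤ) - 1 + ((∑ α ∈ κ, n α : ℕ) : ℤ) + 1).toNat = 0 := by omega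
      have e3 : MvPowerSeries.truncTotal 0 (1 : MvPowerSeries (Fin r) k) = 0 := by
        ext m; simp [MvPowerSeries.coeff_truncTotal_eq_ite]
      rw [e1, e2, e3, MvPowerSeries.truncTotal_one one_ne_zero, Localization.mk_zero, sub_zero]
      have hone : ∀ α ∈ κ, n α = 1 := by
        have h3 : ∑ α ∈ κ, 1 = ∑ α ∈ κ, n α := by
          rw [← Finset.card_eq_sum_ones]; omega
        exact fun α hα => ((Finset.sum_eq_sum_iff_of_le fun α hα => hn α hα).1 h3 α hα).symm
      refine Submodule.subset_span ⟨κ, ⟨?_, hκ⟩, ?_⟩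
      · rw [LinearIndepOn]
        apply linearIndependent_of_top_le_span_of_card_eq_finrank
        · rw [← hκ, Set.image_eq_range]
        · simp only [hfin, Fintype.card_coe, Finset.coe_sort_coe]; omega
      · congr 1
        exact Finset.prod_congr rfl fun α hα => by rw [hone α hα, pow_one]
    · have e1 : (-(r : ℤ) + ((∑ α ∈ κ, n α : ℕ) : ℤ) + 1).toNat ≠ 0 := by omega
      have e2 : (-(r : ℤ) - 1 + ((∑ α ∈ κ, n α : ℕ) : ℤ) + 1).toNat ≠ 0 := by omega
      rw [MvPowerSeries.truncTotal_one e1, MvPowerSeries.truncTotal_one e2, sub_self]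
      exact zero_mem _

/-- The projection of `G_Δ` onto its part `S_Δ` of degree `-r`. -/
def GtoS (b : Module.Basis (Fin r) k V) (Δ : Finset V) : G b Δ →ₗ[k] S b Δ :=
  ((degPart b Δ (-r)) ∘ₗ (G b Δ).subtype).codRestrict (S b Δ) fun φ => degPart_mem b Δ φ φ.2

/-- `Princ_Δ : R̂_Δ → G_Δ`: the Taylor expansion at order `-r` followed by the projection
attached to the decomposition `R_Δ = G_Δ ⊕ NG_Δ`. -/
def princ (b : Module.Basis (Fin r) k V) (Δ : Finset V) (h : IsCompl (G b Δ) (NG b Δ)) :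
    RDeltaHat b Δ →ₗ[k] G b Δ :=
  (G b Δ).projectionOnto (NG b Δ) h ∘ₗ taylor b Δ (-r)

/-- The Jeffrey-Kirwan residue `Res_Δ : R̂_Δ → S_Δ`. -/
def res (b : Module.Basis (Fin r) k V) (Δ : Finset V) (h : IsCompl (G b Δ) (NG b Δ)) :
    RDeltaHat b Δ →ₗ[k] S b Δ :=
  GtoS b Δ ∘ₗ princ b Δ h

/-- The regular elements of `V*`. -/
def Regular (Δ : Finset V) (y : Module.Dual k V) : Prop := ∀ α ∈ Δ, y α ≠ 0

theorem aeval_linForm (b : Module.Basis (Fin r) k V) (y : Module.Dual k V) (α : V) :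
    MvPolynomial.aeval (fun i => y (b i)) (linForm b α) = y α := by
  conv_rhs => rw [← b.sum_repr α, map_sum]
  simp [linForm]

/-- Evaluation of functions in `R_Δ` at a regular element `y` of `V*`. -/
def evalAt (b : Module.Basis (Fin r) k V) (Δ : Finset V) (y : Module.Dual k V)
    (hy : Regular Δ y) : RDelta b Δ →ₐ[k] k :=
  IsLocalization.liftAlgHom (M := denoms b Δ) (f := MvPolynomial.aeval fun i => y (b i))
    (isUnit_of_mem_denoms b Δ _ fun α hα => by
      rw [aeval_linForm]; exact (hy α hα).isUnit)

/-- `C(y)`: the Taylor series at `z = 0` of `z ↦ ψ (y - z)`, for `y` regular and `ψ ∈ R_Δ`. -/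
def reflect (b : Module.Basis (Fin r) k V) (Δ : Finset V) (y : Module.Dual k V)
    (hy : Regular Δ y) : RDelta b Δ →ₐ[k] MvPowerSeries (Fin r) k :=
  IsLocalization.liftAlgHom (M := denoms b Δ)
    (f := MvPolynomial.aeval fun i => MvPowerSeries.C (y (b i)) - MvPowerSeries.X i)
    (isUnit_of_mem_denoms b Δ _ fun α hα => by
      rw [MvPowerSeries.isUnit_iff_constantCoeff]
      have h : MvPowerSeries.constantCoeff (MvPolynomial.aeval (fun i =>
          (MvPowerSeries.C (y (b i)) - MvPowerSeries.X i : MvPowerSeries (Fin r) k))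
            (linForm b α)) = y α := by
        rw [← aeval_linForm b y α]
        simp [linForm, MvPowerSeries.algebraMap_apply]
      rw [h]; exact (hy α hα).isUnit)

/-- The endomorphism `ψ ↦ Res_Δ (φ(z) ψ(y - z))` of `S_Δ`, i.e. `Res_Δ ∘ m(φ) ∘ C(y)`. -/
def cauchyOp (b : Module.Basis (Fin r) k V) (Δ : Finset V) (h : IsCompl (G b Δ) (NG b Δ))
    (y : Module.Dual k V) (hy : Regular Δ y) (φ : RDeltaHat b Δ) : S b Δ →ₗ[k] S b Δ :=
  res b Δ h ∘ₗ LinearMap.mulLeft k φ ∘ₗ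
    (IsScalarTower.toAlgHom k (MvPowerSeries (Fin r) k) (RDeltaHat b Δ)).toLinearMap ∘ₗ
    (reflect b Δ y hy).toLinearMap ∘ₗ (S b Δ).subtype

/-- The formal power series `e^{-h} = ∑ₙ (-h)ⁿ / n!`, the Taylor series at the origin of
`z ↦ e^{-⟨h, z⟩}`. -/
def expNeg [CharZero k] (b : Module.Basis (Fin r) k V) (h : V) : MvPowerSeries (Fin r) k :=
  (PowerSeries.exp k).subst (-(linForm b h : MvPowerSeries (Fin r) k))

/-- `p ↦ p(z + ε eᵢ)` for polynomials `p`, with `ε² = 0`, where `eᵢ` is the `i`-th vector of the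
basis of `V*` dual to `b`. -/
def shiftPoly (b : Module.Basis (Fin r) k V) (Δ : Finset V) (i : Fin r) :
    MvPolynomial (Fin r) k →ₐ[k] DualNumber (RDelta b Δ) :=
  MvPolynomial.aeval fun j =>
    TrivSqZeroExt.inl (algebraMap (MvPolynomial (Fin r) k) (RDelta b Δ) (MvPolynomial.X j))
      + (if j = i then DualNumber.eps else 0)

theorem fst_shiftPoly (b : Module.Basis (Fin r) k V) (Δ : Finset V) (i : Fin r)
    (p : MvPolynomial (Fin r) k) :
    TrivSqZeroExt.fst (shiftPoly b Δ i p) = algebraMap _ (RDelta b Δ) p := by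
  have h : (TrivSqZeroExt.fstHom k (RDelta b Δ) (RDelta b Δ)).comp (shiftPoly b Δ i)
      = IsScalarTower.toAlgHom k (MvPolynomial (Fin r) k) (RDelta b Δ) := by
    apply MvPolynomial.algHom_ext
    intro j
    by_cases hj : j = i <;> simp [shiftPoly, hj]
  exact DFunLike.congr_fun h p

/-- `φ ↦ φ(z + ε eᵢ)` for `φ ∈ R_Δ`, with `ε² = 0`. -/
def shift (b : Module.Basis (Fin r) k V) (Δ : Finset V) (i : Fin r) :
    RDelta b Δ →ₐ[k] DualNumber (RDelta b Δ) :=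
  IsLocalization.liftAlgHom (M := denoms b Δ) (S := RDelta b Δ) (P := DualNumber (RDelta b Δ))
    (f := shiftPoly b Δ i) fun d => by
    have h : IsUnit (TrivSqZeroExt.fst (shiftPoly b Δ i d)) := by
      rw [fst_shiftPoly]
      exact IsLocalization.map_units _ d
    exact TrivSqZeroExt.isUnit_iff_isUnit_fst.2 h

/-- The partial derivative `∂ / ∂zᵢ` of rational functions: the coefficient of `ε` in
`φ(z + ε eᵢ)`. -/
def partialDeriv (b : Module.Basis (Fin r) k V) (Δ : Finset V) (i : Fin r) :
    RDelta b Δ →ₗ[k] RDelta b Δ :=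
  (TrivSqZeroExt.sndHom (RDelta b Δ) (RDelta b Δ)).restrictScalars k ∘ₗ (shift b Δ i).toLinearMap

/-- The differential operator with constant coefficients `P(∂/∂z₁, …, ∂/∂z_r)` on `R_Δ` defined
by a polynomial `P` (a polynomial function on `V`, i.e. an element of `S(V*)`). -/
def diffOp (b : Module.Basis (Fin r) k V) (Δ : Finset V) (P : MvPolynomial (Fin r) k) :
    RDelta b Δ →ₗ[k] RDelta b Δ :=
  ∑ m ∈ P.support, P.coeff m • (List.ofFn fun i => partialDeriv b Δ i ^ m i).prod

end JK

end

noncomputable section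

namespace JK

variable {k : Type*} [Field k] {V : Type*} [AddCommGroup V] [Module k V] {r : ℕ}
  (b : Module.Basis (Fin r) k V) (Δ : Finset V)

/-! ### Linear forms and their inverses -/

/-! The proof reduces both assertions to basic fractions `∏_{α ∈ σ} α ^ (-n_α)`, with `σ ⊂ Δ` a
basis of `V` and all `n_α > 0`, where they become one-variable computations.

Reduction. Partial fractions (`prod_invR_mem_basicFractions_sup`) show that `R_Δ` is spanned by
`NG_Δ` and the basic fractions. Elements of `NG_Δ` and Taylor tails of high order are killed by
`Princ_Δ`, even after multiplication by any power series. Both assertions are linear in `φ` and see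
it only through such products, so it suffices to treat basic fractions (`RDeltaHat_induction`).

Computation. In the coordinates `α ∈ σ`, the map `p ↦ Res_Δ (p ∏ α ^ (-n_α))` extracts from `p` the
coefficient of `∏ α ^ (n_α - 1)` and multiplies it by `φ_σ = ∏ α⁻¹` (`fracRes_prod`). For the trace,
the operator takes values in the line of `φ_σ`, so its trace is its eigenvalue there; expanding each
`1 / (⟨α, y⟩ - α)` as a geometric series gives `∏ ⟨α, y⟩ ^ (-n_α)`, the value of the fraction at `y`
(`trace_cauchyOp_prod_invR`). For `p = e^{-h}` the coefficient is `∏ (-α^*(h)) ^ (n_α - 1) / (n_α -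
1)!` (`fracRes_expNeg`), and the corresponding differential operator carries `φ_σ` to the given
fraction (`diffHom_fracPoly`).

Directness of `R_Δ = G_Δ ⊕ NG_Δ` comes from directional derivatives: each element of `NG_Δ` is
annihilated by a product of them, whereas every nonzero directional derivative is injective on
`G_Δ`, whose elements decay in every direction. -/

theorem linForm_add (α β : V) : linForm b (α + β) = linForm b α + linForm b β := by
  simp [linForm, add_mul, Finset.sum_add_distrib]

theorem linForm_smul (c : k) (α : V) : linForm b (c • α) = c • linForm b α := by
  simp [linForm, Finset.smul_sum, MvPolynomial.smul_eq_C_mul, mul_assoc]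

/-- `linForm` as a linear map. -/
def linFormₗ : V →ₗ[k] MvPolynomial (Fin r) k where
  toFun := linForm b
  map_add' := linForm_add b
  map_smul' := linForm_smul b

@[simp] theorem linFormₗ_apply (α : V) : linFormₗ b α = linForm b α := rfl

theorem linForm_basis (i : Fin r) : linForm b (b i) = MvPolynomial.X i := by
  simp [linForm, Finsupp.single_apply, apply_ite, ite_mul]

theorem linForm_ne_zero {α : V} (h : α ≠ 0) : linForm b α ≠ 0 := by
  intro h0
  apply h
  apply b.ext_elem
  intro i
  have := congrArg (MvPolynomial.coeff (Finsupp.single i 1)) h0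
  simpa [linForm, MvPolynomial.coeff_sum, MvPolynomial.coeff_C_mul, MvPolynomial.coeff_X,
    Finsupp.single_left_inj] using this

/-- A vector as an element of `R_Δ`. -/
def linR : V →ₗ[k] RDelta b Δ :=
  (IsScalarTower.toAlgHom k (MvPolynomial (Fin r) k) (RDelta b Δ)).toLinearMap ∘ₗ linFormₗ b

theorem linR_apply (α : V) : linR b Δ α = algebraMap _ _ (linForm b α) := rfl

/-- The inverse of `α ∈ Δ` in `R_Δ`. -/
def invR (α : Δ) : RDelta b Δ := Localization.mk 1 (den b Δ α)

theorem linR_mul_invR (α : Δ) : linR b Δ α * invR b Δ α = 1 := by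
  rw [linR_apply, invR, ← Localization.mk_one_eq_algebraMap, Localization.mk_mul, one_mul, mul_one]
  exact Localization.mk_self (den b Δ α)

theorem invR_mul_linR (α : Δ) : invR b Δ α * linR b Δ α = 1 := by
  rw [mul_comm, linR_mul_invR]

theorem mk_prod (ψ : MvPolynomial (Fin r) k) (κ : Finset Δ) (n : Δ → ℕ) :
    (Localization.mk ψ (∏ α ∈ κ, den b Δ α ^ n α) : RDelta b Δ)
      = algebraMap _ _ ψ * ∏ α ∈ κ, invR b Δ α ^ n α := by
  have h : ∏ α ∈ κ, invR b Δ α ^ n α = Localization.mk 1 (∏ α ∈ κ, den b Δ α ^ n α) := by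
    simp only [invR, Localization.mk_pow, one_pow, Localization.mk_prod, Finset.prod_const_one]
  rw [h, ← Localization.mk_one_eq_algebraMap, Localization.mk_mul, one_mul, mul_one]

theorem mk_one_prod (κ : Finset Δ) (n : Δ → ℕ) :
    (Localization.mk 1 (∏ α ∈ κ, den b Δ α ^ n α) : RDelta b Δ)
      = ∏ α ∈ κ, invR b Δ α ^ n α := by
  rw [mk_prod, map_one, one_mul]

theorem prod_invR_mem_G {κ : Finset Δ} (hκ : Generating k κ) {n : Δ → ℕ}
    (hn : ∀ α ∈ κ, 0 < n α) : ∏ α ∈ κ, invR b Δ α ^ n α ∈ G b Δ :=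
  Submodule.subset_span ⟨κ, n, hκ, hn, (mk_one_prod b Δ κ n).symm⟩

theorem prod_invR_mem_S {σ : Finset Δ} (hσ : IsBasis k σ) : ∏ α ∈ σ, invR b Δ α ∈ S b Δ := by
  refine Submodule.subset_span ⟨σ, hσ, ?_⟩
  simpa using (mk_one_prod b Δ σ fun _ => 1).symm

theorem mul_prod_invR_mem_NG {κ : Finset Δ} (hκ : ¬ Generating k κ) (n : Δ → ℕ)
    (ψ : MvPolynomial (Fin r) k) :
    algebraMap _ _ ψ * ∏ α ∈ κ, invR b Δ α ^ n α ∈ NG b Δ :=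
  Submodule.subset_span ⟨κ, n, ψ, hκ, (mk_prod b Δ ψ κ n).symm⟩

theorem prod_invR_mem_NG {κ : Finset Δ} (hκ : ¬ Generating k κ) (n : Δ → ℕ) :
    ∏ α ∈ κ, invR b Δ α ^ n α ∈ NG b Δ := by
  simpa using mul_prod_invR_mem_NG b Δ hκ n 1

theorem algebraMap_mul_mem_NG (ψ : MvPolynomial (Fin r) k) {x : RDelta b Δ} (hx : x ∈ NG b Δ) :
    algebraMap _ _ ψ * x ∈ NG b Δ := by
  unfold NG at hx
  induction hx using Submodule.span_induction with
  | zero => rw [mul_zero]; exact zero_mem _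
  | add x y _ _ hx hy => rw [mul_add]; exact add_mem hx hy
  | smul c x _ hx => rw [mul_smul_comm]; exact Submodule.smul_mem _ c hx
  | mem x hx =>
    obtain ⟨κ, n, χ, hκ, rfl⟩ := hx
    rw [mk_prod, ← mul_assoc, ← map_mul]
    exact mul_prod_invR_mem_NG b Δ hκ n _

theorem denoms_exists_eq_prod (d : denoms b Δ) : ∃ n : Δ → ℕ, d = ∏ α, den b Δ α ^ n α := by
  obtain ⟨d, hd⟩ := d
  suffices h : ∃ n : Δ → ℕ, d = ∏ α : Δ, linForm b (α : V) ^ n α by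
    obtain ⟨n, hn⟩ := h
    exact ⟨n, Subtype.ext (by simpa [den, Submonoid.coe_finsetProd] using hn)⟩
  change d ∈ Submonoid.closure _ at hd
  induction hd using Submonoid.closure_induction with
  | mem x hx =>
    classical
    obtain ⟨α, hα, rfl⟩ := hx
    refine ⟨Pi.single ⟨α, hα⟩ 1, ?_⟩
    rw [Finset.prod_eq_single (⟨α, hα⟩ : Δ)]
    · simp
    · intro β _ hβ; simp [Pi.single_eq_of_ne hβ]
    · simp
  | one => exact ⟨0, by simp⟩
  | mul x y _ _ hx hy =>
    obtain ⟨m, hm⟩ := hx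
    obtain ⟨n, hn⟩ := hy
    exact ⟨m + n, by simp [hm, hn, pow_add, Finset.prod_mul_distrib]⟩

variable {Δ}

theorem denoms_le_nonZeroDivisors (hΔ₀ : ∀ α ∈ Δ, α ≠ 0) :
    denoms b Δ ≤ nonZeroDivisors (MvPolynomial (Fin r) k) := by
  refine (Submonoid.closure_le).2 ?_
  rintro _ ⟨α, hα, rfl⟩
  exact mem_nonZeroDivisors_of_ne_zero (linForm_ne_zero b (hΔ₀ α hα))

theorem denoms_ne_zero (hΔ₀ : ∀ α ∈ Δ, α ≠ 0) (d : denoms b Δ) :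
    (d : MvPolynomial (Fin r) k) ≠ 0 :=
  nonZeroDivisors.ne_zero (denoms_le_nonZeroDivisors b hΔ₀ d.2)

theorem algebraMap_injective (hΔ₀ : ∀ α ∈ Δ, α ≠ 0) :
    Function.Injective (algebraMap (MvPolynomial (Fin r) k) (RDelta b Δ)) :=
  IsLocalization.injective _ (denoms_le_nonZeroDivisors b hΔ₀)

theorem nontrivial_RDelta (hΔ₀ : ∀ α ∈ Δ, α ≠ 0) : Nontrivial (RDelta b Δ) :=
  (algebraMap_injective b hΔ₀).nontrivial

theorem prod_invR_ne_zero (hΔ₀ : ∀ α ∈ Δ, α ≠ 0) (σ : Finset Δ) (n : Δ → ℕ) :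
    ∏ α ∈ σ, invR b Δ α ^ n α ≠ 0 := by
  have := nontrivial_RDelta b hΔ₀
  refine IsUnit.ne_zero (IsUnit.of_mul_eq_one (∏ α ∈ σ, linR b Δ α ^ n α) ?_)
  rw [← Finset.prod_mul_distrib]
  refine Finset.prod_eq_one fun α _ => ?_
  rw [← mul_pow, invR_mul_linR, one_pow]

/-! ### Partial fractions -/

variable (Δ)

/-- The span of the `∏_{α ∈ σ} α ^ (-n_α)` with `σ ∈ 𝒮` a basis of `Δ` and all `n_α > 0`. -/
def basicFractions (𝒮 : Set (Finset Δ)) : Submodule k (RDelta b Δ) :=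
  Submodule.span k {x | ∃ σ ∈ 𝒮, ∃ n : Δ → ℕ, IsBasis k σ ∧ (∀ α ∈ σ, 0 < n α) ∧
    x = ∏ α ∈ σ, invR b Δ α ^ n α}

theorem basicFractions_le_G (𝒮 : Set (Finset Δ)) : basicFractions b Δ 𝒮 ≤ G b Δ := by
  refine Submodule.span_le.2 ?_
  rintro _ ⟨σ, -, n, hσ, hn, rfl⟩
  exact prod_invR_mem_G b Δ hσ.2 hn

theorem not_generating_erase [DecidableEq Δ] {σ : Finset Δ}
    (hσ : LinearIndepOn k (fun α : Δ => (α : V)) (σ : Set Δ)) {α : Δ} (hα : α ∈ σ) :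
    ¬ Generating k (σ.erase α) := by
  intro h
  have h1 := (linearIndepOn_iff_notMem_span.1 hσ) α hα
  rw [← Finset.coe_erase, show Submodule.span k ((fun α : Δ => (α : V)) '' _) = ⊤ from h] at h1
  exact h1 trivial

theorem linR_mul_prod_invR [DecidableEq Δ] {σ : Finset Δ} {α : Δ} (hα : α ∈ σ) (n : Δ → ℕ)
    (hn : 0 < n α) :
    linR b Δ α * ∏ β ∈ σ, invR b Δ β ^ n β
      = ∏ β ∈ σ, invR b Δ β ^ Function.update n α (n α - 1) β := by
  rw [← Finset.mul_prod_erase _ _ hα, ← Finset.mul_prod_erase _ _ hα, ← mul_assoc]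
  congr 1
  · obtain ⟨m, hm⟩ : ∃ m, n α = m + 1 := ⟨n α - 1, by omega⟩
    rw [Function.update_self, hm, pow_succ', ← mul_assoc, linR_mul_invR, one_mul,
      Nat.add_sub_cancel]
  · refine Finset.prod_congr rfl fun β hβ => ?_
    rw [Function.update_of_ne (Finset.ne_of_mem_erase hβ)]

/-- Expand `v` in the basis `σ`: each `α ∈ σ` lowers one exponent of the fraction, and if that
exponent reaches `0`, the remaining denominators no longer generate and the product falls into `NG`.
The bases involved never change, which is why an arbitrary `𝒮` is allowed; `fracRes_mem_span` uses
`𝒮 = {σ}`. -/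
theorem linR_mul_mem_basicFractions_sup {𝒮 : Set (Finset Δ)} {x : RDelta b Δ} (v : V)
    (hx : x ∈ NG b Δ ⊔ basicFractions b Δ 𝒮) : linR b Δ v * x ∈ NG b Δ ⊔ basicFractions b Δ 𝒮 := by
  classical
  obtain ⟨y, hy, z, hz, rfl⟩ := Submodule.mem_sup.1 hx
  rw [mul_add]
  refine add_mem (Submodule.mem_sup_left (algebraMap_mul_mem_NG b Δ _ hy)) ?_
  clear hx hy
  unfold basicFractions at hz
  induction hz using Submodule.span_induction with
  | zero => rw [mul_zero]; exact zero_mem _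
  | add x y _ _ hx hy => rw [mul_add]; exact add_mem hx hy
  | smul c x _ hx => rw [mul_smul_comm]; exact Submodule.smul_mem _ c hx
  | mem x hx =>
    obtain ⟨σ, hσ𝒮, n, hσ, hn, rfl⟩ := hx
    have hv : v ∈ Submodule.span k ((fun α : Δ => (α : V)) '' (σ : Set Δ)) := by
      rw [show Submodule.span k ((fun α : Δ => (α : V)) '' (σ : Set Δ)) = ⊤ from hσ.2]; trivial
    induction hv using Submodule.span_induction with
    | zero => rw [map_zero, zero_mul]; exact zero_mem _
    | add x y _ _ hx hy => rw [map_add, add_mul]; exact add_mem hx hy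
    | smul c x _ hx => rw [map_smul, smul_mul_assoc]; exact Submodule.smul_mem _ c hx
    | mem x hx =>
      obtain ⟨α, hα, rfl⟩ := hx
      have hα' : α ∈ σ := hα
      simp only
      rw [linR_mul_prod_invR b Δ hα' n (hn α hα')]
      by_cases h1 : n α = 1
      · refine Submodule.mem_sup_left ?_
        rw [← Finset.mul_prod_erase _ _ hα', Function.update_self, h1, Nat.sub_self, pow_zero,
          one_mul]
        exact prod_invR_mem_NG b Δ (not_generating_erase Δ hσ.1 hα') _
      · refine Submodule.mem_sup_right (Submodule.subset_span ⟨σ, hσ𝒮, _, hσ, fun β hβ => ?_, rfl⟩)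
        have h2 := hn α hα'
        rcases eq_or_ne β α with rfl | h
        · rw [Function.update_self]; omega
        · rw [Function.update_of_ne h]; exact hn β hβ

theorem algebraMap_mul_mem_basicFractions_sup {𝒮 : Set (Finset Δ)} {x : RDelta b Δ}
    (ψ : MvPolynomial (Fin r) k) (hx : x ∈ NG b Δ ⊔ basicFractions b Δ 𝒮) :
    algebraMap _ _ ψ * x ∈ NG b Δ ⊔ basicFractions b Δ 𝒮 := by
  induction ψ using MvPolynomial.induction_on generalizing x with
  | C c =>
    rw [← MvPolynomial.algebraMap_eq, ← IsScalarTower.algebraMap_apply, ← Algebra.smul_def]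
    exact Submodule.smul_mem _ c hx
  | add p q hp hq => rw [map_add, add_mul]; exact add_mem (hp hx) (hq hx)
  | mul_X p i hp =>
    rw [map_mul, mul_assoc, ← linForm_basis b i]
    exact hp (linR_mul_mem_basicFractions_sup b Δ (b i) hx)

/-- Partial fractions: a linear relation among the elements of `s` is used to move exponents onto a
single `α` until another factor disappears, and `s` shrinks. -/
theorem prod_invR_mem_basicFractions_sup (s : Finset Δ) (n : Δ → ℕ) :
    ∏ α ∈ s, invR b Δ α ^ n α ∈ NG b Δ ⊔ basicFractions b Δ Set.univ := by
  classical
  induction s using Finset.strongInduction generalizing n with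
  | H s ih =>
  by_cases hz : ∃ β ∈ s, n β = 0
  · obtain ⟨β, hβ, h0⟩ := hz
    rw [← Finset.mul_prod_erase _ _ hβ, h0, pow_zero, one_mul]
    exact ih _ (Finset.erase_ssubset hβ) n
  by_cases hs : LinearIndepOn k (fun α : Δ => (α : V)) (s : Set Δ)
  · by_cases hg : Generating k s
    · refine Submodule.mem_sup_right (Submodule.subset_span ⟨s, trivial, n, ⟨hs, hg⟩, ?_, rfl⟩)
      push Not at hz
      exact fun α hα => Nat.pos_of_ne_zero (hz α hα)
    · exact Submodule.mem_sup_left (prod_invR_mem_NG b Δ hg n)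
  clear hz
  rw [not_linearIndepOn_finset_iff] at hs
  obtain ⟨g, hg, α, hα, hgα⟩ := hs
  -- The relation `g` and the vector `α` are fixed here, so every step feeds the same `α` and the
  -- total exponent of the other factors decreases.
  induction hN : ∑ β ∈ s.erase α, n β using Nat.strong_induction_on generalizing n with
  | _ N ihN =>
  by_cases hz : ∃ β ∈ s, n β = 0
  · obtain ⟨β, hβ, h0⟩ := hz
    rw [← Finset.mul_prod_erase _ _ hβ, h0, pow_zero, one_mul]
    exact ih _ (Finset.erase_ssubset hβ) n
  push Not at hz
  -- The relation solved for `α` and divided by `α`; multiplying by the term in `β / α` moves one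
  -- unit of exponent from `β` to `α`.
  have h1 : (1 : RDelta b Δ)
      = ∑ β ∈ s.erase α, (-(g α)⁻¹ * g β) • (invR b Δ α * linR b Δ (β : V)) := by
    have h2 : (α : V) = ∑ β ∈ s.erase α, (-(g α)⁻¹ * g β) • (β : V) := by
      rw [← Finset.add_sum_erase _ _ hα, ← eq_neg_iff_add_eq_zero] at hg
      simp_rw [neg_mul, neg_smul, mul_smul]
      rw [Finset.sum_neg_distrib, ← Finset.smul_sum, ← smul_neg, ← hg, smul_smul,
        inv_mul_cancel₀ hgα, one_smul]
    rw [← invR_mul_linR b Δ α]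
    conv_lhs => rw [h2, map_sum, Finset.mul_sum]
    exact Finset.sum_congr rfl fun β _ => by rw [map_smul, mul_smul_comm]
  rw [← one_mul (∏ β ∈ s, invR b Δ β ^ n β), h1, Finset.sum_mul]
  refine Submodule.sum_mem _ fun β hβ => ?_
  have hβs := Finset.mem_of_mem_erase hβ
  have hβα := Finset.ne_of_mem_erase hβ
  rw [smul_mul_assoc, mul_assoc,
    linR_mul_prod_invR b Δ hβs n (Nat.pos_of_ne_zero (hz β hβs))]
  refine Submodule.smul_mem _ _ ?_
  set m := Function.update n β (n β - 1) with hm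
  have h3 : invR b Δ α * ∏ γ ∈ s, invR b Δ γ ^ m γ
      = ∏ γ ∈ s, invR b Δ γ ^ Function.update m α (m α + 1) γ := by
    rw [← Finset.mul_prod_erase _ _ hα, ← Finset.mul_prod_erase _ _ hα, ← mul_assoc,
      Function.update_self, pow_succ']
    congr 1
    refine Finset.prod_congr rfl fun γ hγ => ?_
    rw [Function.update_of_ne (Finset.ne_of_mem_erase hγ)]
  rw [h3]
  refine ihN _ ?_ _ rfl
  have h4 : ∑ γ ∈ s.erase α, Function.update m α (m α + 1) γ = ∑ γ ∈ s.erase α, m γ :=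
    Finset.sum_congr rfl fun γ hγ => Function.update_of_ne (Finset.ne_of_mem_erase hγ) _ _
  rw [h4, ← hN]
  refine Finset.sum_lt_sum (fun γ _ => ?_) ⟨β, hβ, ?_⟩
  · rcases eq_or_ne γ β with rfl | h
    · rw [hm, Function.update_self]; omega
    · rw [hm, Function.update_of_ne h]
  · have := hz β hβs
    rw [hm, Function.update_self]; omega

theorem NG_sup_basicFractions : NG b Δ ⊔ basicFractions b Δ Set.univ = ⊤ := by
  refine eq_top_iff.2 fun x _ => ?_
  induction x using Localization.induction_on with
  | H p =>
  obtain ⟨ψ, d⟩ := p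
  obtain ⟨n, rfl⟩ := denoms_exists_eq_prod b Δ d
  rw [mk_prod]
  exact algebraMap_mul_mem_basicFractions_sup b Δ ψ (prod_invR_mem_basicFractions_sup b Δ _ n)

/-! ### Derivations and commuting operators -/

theorem derivation_inv {A : Type*} [CommRing A] [Algebra k A] (D : Derivation k A A) {u a : A}
    (h : u * a = 1) {c : k} (hD : D a = algebraMap k A c) : D u = (-c) • u ^ 2 := by
  rw [Derivation.leibniz_of_mul_eq_one _ h, hD, smul_eq_mul, Algebra.smul_def, map_neg]
  ring

theorem derivation_inv_pow {A : Type*} [CommRing A] [Algebra k A] (D : Derivation k A A) {u a : A}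
    (h : u * a = 1) {c : k} (hD : D a = algebraMap k A c) (n : ℕ) :
    D (u ^ n) = (-(n * c)) • u ^ (n + 1) := by
  rw [Derivation.leibniz_pow, derivation_inv D h hD]
  rcases n with _ | n
  · simp
  · simp only [smul_eq_mul, nsmul_eq_mul, Nat.add_sub_cancel]
    simp only [Algebra.smul_def, map_neg, map_mul, map_natCast]
    ring

theorem derivation_prod_inv_pow {A ι : Type*} [CommRing A] [Algebra k A] (D : Derivation k A A)
    {u a : ι → A} (h : ∀ i, u i * a i = 1) {c : ι → k} (hD : ∀ i, D (a i) = algebraMap k A (c i))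
    (s : Finset ι) (n : ι → ℕ) :
    D (∏ i ∈ s, u i ^ n i) = ∑ i ∈ s, (-(n i * c i)) • (u i * ∏ j ∈ s, u j ^ n j) := by
  classical
  induction s using Finset.induction_on with
  | empty => simp
  | insert i s hi ih =>
    rw [Finset.prod_insert hi, Derivation.leibniz, ih, derivation_inv_pow D (h i) (hD i),
      Finset.sum_insert hi, Finset.smul_sum, add_comm]
    congr 1
    · simp only [smul_eq_mul]; simp only [Algebra.smul_def]; ring
    · refine Finset.sum_congr rfl fun j _ => ?_
      simp only [smul_eq_mul]; simp only [Algebra.smul_def]; ring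

/-- Evaluation of polynomials at pairwise commuting elements of a noncommutative algebra. -/
def commAeval {ι E : Type*} [Ring E] [Algebra k E] (d : ι → E) (h : ∀ i j, Commute (d i) (d j)) :
    MvPolynomial ι k →ₐ[k] E :=
  letI : CommRing (Algebra.adjoin k (Set.range d)) :=
    { (inferInstance : Ring (Algebra.adjoin k (Set.range d))) with
      mul_comm := (Algebra.isMulCommutative_adjoin k (by
        rintro _ ⟨i, rfl⟩ _ ⟨j, rfl⟩
        exact h i j)).is_comm.comm }
  (Algebra.adjoin k (Set.range d)).val.comp (MvPolynomial.aeval fun i =>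
    (⟨d i, Algebra.subset_adjoin ⟨i, rfl⟩⟩ : Algebra.adjoin k (Set.range d)))

theorem commAeval_X {ι E : Type*} [Ring E] [Algebra k E] (d : ι → E)
    (h : ∀ i j, Commute (d i) (d j)) (i : ι) :
    commAeval d h (MvPolynomial.X i : MvPolynomial ι k) = d i := by
  simp [commAeval]

theorem commAeval_eq_sum {r : ℕ} {E : Type*} [Ring E] [Algebra k E] (d : Fin r → E)
    (h : ∀ i j, Commute (d i) (d j)) (P : MvPolynomial (Fin r) k) :
    commAeval d h P = ∑ m ∈ P.support, P.coeff m • (List.ofFn fun i => d i ^ m i).prod := by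
  conv_lhs => rw [← P.support_sum_monomial_coeff]
  rw [map_sum]
  refine Finset.sum_congr rfl fun m _ => ?_
  rw [MvPolynomial.monomial_eq, ← MvPolynomial.smul_eq_C_mul, map_smul,
    Finsupp.prod_fintype _ _ (fun _ => pow_zero _), ← List.prod_ofFn, map_list_prod, List.map_ofFn]
  congr 3
  funext i
  simp [commAeval_X]

/-! ### Derivations of `R_Δ` -/

theorem shift_algebraMap (i : Fin r) (p : MvPolynomial (Fin r) k) :
    shift b Δ i (algebraMap _ _ p) = shiftPoly b Δ i p := by
  rw [shift, IsLocalization.coe_liftAlgHom, IsLocalization.lift_eq]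
  rfl

theorem fst_shift (i : Fin r) (x : RDelta b Δ) : TrivSqZeroExt.fst (shift b Δ i x) = x := by
  obtain ⟨⟨p, d⟩, h⟩ := IsLocalization.surj (denoms b Δ) x
  simp only at h
  have h1 := congrArg (fun z : RDelta b Δ => TrivSqZeroExt.fst (shift b Δ i z)) h
  simp only [map_mul, TrivSqZeroExt.fst_mul, shift_algebraMap, fst_shiftPoly] at h1
  rw [← h] at h1
  exact (IsLocalization.map_units (RDelta b Δ) d).mul_left_injective h1

theorem partialDeriv_apply (i : Fin r) (x : RDelta b Δ) :
    partialDeriv b Δ i x = TrivSqZeroExt.snd (shift b Δ i x) := rfl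

/-- `partialDeriv` as a derivation. -/
def partialDerivation (i : Fin r) : Derivation k (RDelta b Δ) (RDelta b Δ) :=
  Derivation.mk' (partialDeriv b Δ i) fun x y => by
    simp [mul_comm y, partialDeriv_apply, TrivSqZeroExt.snd_mul, fst_shift]

theorem partialDerivation_algebraMap_X (i j : Fin r) :
    partialDerivation b Δ i (algebraMap (MvPolynomial (Fin r) k) _ (MvPolynomial.X j))
      = if j = i then 1 else 0 := by
  rw [partialDerivation, Derivation.coe_mk', partialDeriv_apply, shift_algebraMap]
  by_cases h : j = i <;> simp [shiftPoly, h]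

variable {b Δ} in
theorem derivation_ext {D D' : Derivation k (RDelta b Δ) (RDelta b Δ)}
    (h : ∀ i, D (algebraMap (MvPolynomial (Fin r) k) _ (MvPolynomial.X i))
      = D' (algebraMap (MvPolynomial (Fin r) k) _ (MvPolynomial.X i))) :
    D = D' := by
  have hp : ∀ p : MvPolynomial (Fin r) k, D (algebraMap _ _ p) = D' (algebraMap _ _ p) := by
    intro p
    induction p using MvPolynomial.induction_on with
    | C c =>
      rw [← MvPolynomial.algebraMap_eq, ← IsScalarTower.algebraMap_apply,
        Derivation.map_algebraMap, Derivation.map_algebraMap]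
    | add p q hp hq => rw [map_add, map_add, map_add, hp, hq]
    | mul_X p i hp => rw [map_mul, Derivation.leibniz, Derivation.leibniz, hp, h]
  ext x
  obtain ⟨⟨p, d⟩, hx⟩ := IsLocalization.surj (denoms b Δ) x
  simp only at hx
  have h1 : D (x * algebraMap _ _ (d : MvPolynomial (Fin r) k))
      = D' (x * algebraMap _ _ (d : MvPolynomial (Fin r) k)) := by rw [hx, hp]
  rw [Derivation.leibniz, Derivation.leibniz, hp d, add_right_inj] at h1
  simp only [smul_eq_mul] at h1
  exact (IsLocalization.map_units (RDelta b Δ) d).mul_right_injective h1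

/-- The derivative in the direction `w ∈ V*`. -/
def dirDeriv (w : Module.Dual k V) : Derivation k (RDelta b Δ) (RDelta b Δ) :=
  ∑ i, w (b i) • partialDerivation b Δ i

theorem dirDeriv_apply (w : Module.Dual k V) (x : RDelta b Δ) :
    dirDeriv b Δ w x = ∑ i, w (b i) • partialDeriv b Δ i x := by
  have h := congrArg (fun f => f x) (map_sum (Derivation.coeFnAddMonoidHom (R := k)
    (A := RDelta b Δ) (M := RDelta b Δ)) (fun i => w (b i) • partialDerivation b Δ i) Finset.univ)
  simp only [Derivation.coeFnAddMonoidHom_apply, Finset.sum_apply, Derivation.smul_apply] at h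
  exact h

theorem dirDeriv_linR (w : Module.Dual k V) (α : V) :
    dirDeriv b Δ w (linR b Δ α) = algebraMap k _ (w α) := by
  have h : ∀ i, dirDeriv b Δ w (linR b Δ (b i)) = algebraMap k _ (w (b i)) := by
    intro i
    rw [dirDeriv_apply, linR_apply, linForm_basis, Finset.sum_eq_single i]
    · have := partialDerivation_algebraMap_X b Δ i i
      rw [if_pos rfl] at this
      rw [show partialDeriv b Δ i _ = 1 from this, Algebra.algebraMap_eq_smul_one]
    · intro j _ hj
      have := partialDerivation_algebraMap_X b Δ j i
      rw [if_neg hj.symm] at this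
      rw [show partialDeriv b Δ j _ = 0 from this, smul_zero]
    · simp
  conv_lhs => rw [← b.sum_repr α]
  conv_rhs => rw [← b.sum_repr α]
  simp only [map_sum, map_smul, Derivation.map_smul, h, smul_eq_mul, map_mul]
  exact Finset.sum_congr rfl fun i _ => Algebra.smul_def _ _

/-- The commutator of two derivations is a derivation, and this one vanishes on the coordinates. -/
theorem partialDeriv_commute (i j : Fin r) : Commute (partialDeriv b Δ i) (partialDeriv b Δ j) := by
  have h : ⁅partialDerivation b Δ i, partialDerivation b Δ j⁆ = 0 := by
    refine derivation_ext fun l => ?_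
    rw [Derivation.commutator_apply, partialDerivation_algebraMap_X,
      partialDerivation_algebraMap_X]
    split_ifs <;> simp
  ext x
  have h1 := Derivation.congr_fun h x
  rw [Derivation.commutator_apply, Derivation.zero_apply, sub_eq_zero] at h1
  exact h1

/-- `diffOp` as a homomorphism of algebras. -/
def diffHom : MvPolynomial (Fin r) k →ₐ[k] Module.End k (RDelta b Δ) :=
  commAeval (partialDeriv b Δ) (partialDeriv_commute b Δ)

/-- Since the partial derivatives commute, the ordered products in `diffOp` define an algebra
homomorphism: products of polynomials act by composition. -/
theorem diffOp_eq (P : MvPolynomial (Fin r) k) : diffOp b Δ P = diffHom b Δ P :=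
  (commAeval_eq_sum (E := Module.End k (RDelta b Δ)) (partialDeriv b Δ)
    (partialDeriv_commute b Δ) P).symm

theorem diffHom_X (i : Fin r) : diffHom b Δ (MvPolynomial.X i) = partialDeriv b Δ i := by
  simp [diffHom, commAeval_X]

/-- A vector `w ∈ V*` as a linear form on `V`, in the coordinates attached to `b`. -/
def dualForm (w : Module.Dual k V) : MvPolynomial (Fin r) k :=
  ∑ i, w (b i) • MvPolynomial.X i

theorem diffHom_dualForm (w : Module.Dual k V) (x : RDelta b Δ) :
    diffHom b Δ (dualForm b w) x = dirDeriv b Δ w x := by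
  simp [dualForm, dirDeriv_apply, diffHom_X, LinearMap.sum_apply]

theorem eval_dualForm (w : Module.Dual k V) (h : V) :
    MvPolynomial.eval (b.repr h) (dualForm b w) = w h := by
  conv_rhs => rw [← b.sum_repr h, map_sum]
  simp [dualForm, MvPolynomial.smul_eval, mul_comm]

theorem dirDeriv_prod_invR (w : Module.Dual k V) (κ : Finset Δ) (n : Δ → ℕ) :
    dirDeriv b Δ w (∏ α ∈ κ, invR b Δ α ^ n α)
      = ∑ α ∈ κ, (-(n α * w α)) • (invR b Δ α * ∏ β ∈ κ, invR b Δ β ^ n β) :=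
  derivation_prod_inv_pow _ (invR_mul_linR b Δ) (fun α => dirDeriv_linR b Δ w α) κ n

theorem invR_mul_prod_invR [DecidableEq Δ] {κ : Finset Δ} {α : Δ} (hα : α ∈ κ) (n : Δ → ℕ) :
    invR b Δ α * ∏ β ∈ κ, invR b Δ β ^ n β
      = ∏ β ∈ κ, invR b Δ β ^ Function.update n α (n α + 1) β := by
  rw [← Finset.mul_prod_erase _ _ hα, ← Finset.mul_prod_erase _ _ hα, ← mul_assoc,
    Function.update_self, pow_succ']
  congr 1
  refine Finset.prod_congr rfl fun β hβ => ?_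
  rw [Function.update_of_ne (Finset.ne_of_mem_erase hβ)]

theorem dirDeriv_mem_G (w : Module.Dual k V) {x : RDelta b Δ} (hx : x ∈ G b Δ) :
    dirDeriv b Δ w x ∈ G b Δ := by
  classical
  unfold G at hx
  induction hx using Submodule.span_induction with
  | zero => rw [map_zero]; exact zero_mem _
  | add x y _ _ hx hy => rw [map_add]; exact add_mem hx hy
  | smul c x _ hx => rw [Derivation.map_smul]; exact Submodule.smul_mem _ c hx
  | mem x hx =>
    obtain ⟨κ, n, hκ, hn, rfl⟩ := hx
    rw [mk_one_prod, dirDeriv_prod_invR]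
    refine Submodule.sum_mem _ fun α hα => Submodule.smul_mem _ _ ?_
    rw [invR_mul_prod_invR b Δ hα]
    refine prod_invR_mem_G b Δ hκ fun β hβ => ?_
    rcases eq_or_ne β α with rfl | h
    · rw [Function.update_self]; omega
    · rw [Function.update_of_ne h]; exact hn β hβ

/-! ### Restriction to lines and the sum decomposition -/

/-- `p ↦ p(z + t w)`. -/
def lineMap (w : Module.Dual k V) :
    MvPolynomial (Fin r) k →ₐ[k] Polynomial (MvPolynomial (Fin r) k) :=
  MvPolynomial.aeval fun j =>
    Polynomial.C (MvPolynomial.X j) + Polynomial.C (MvPolynomial.C (w (b j))) * Polynomial.X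

theorem lineMap_X (w : Module.Dual k V) (j : Fin r) :
    lineMap b w (MvPolynomial.X j) =
      Polynomial.C (MvPolynomial.X j) + Polynomial.C (MvPolynomial.C (w (b j))) * Polynomial.X :=
  MvPolynomial.aeval_X _ _

theorem lineMap_C (w : Module.Dual k V) (c : k) :
    lineMap b w (MvPolynomial.C c) = Polynomial.C (MvPolynomial.C c) := by
  rw [← MvPolynomial.algebraMap_eq, AlgHom.commutes]
  rfl

theorem lineMap_linForm (w : Module.Dual k V) (α : V) :
    lineMap b w (linForm b α)
      = Polynomial.C (linForm b α) + Polynomial.C (MvPolynomial.C (w α)) * Polynomial.X := by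
  have hw : w α = ∑ i, b.repr α i * w (b i) := by
    conv_lhs => rw [← b.sum_repr α]
    simp only [map_sum, map_smul, smul_eq_mul]
  rw [hw]
  simp only [linForm, map_sum, map_mul, lineMap_C, lineMap_X, Finset.sum_mul, mul_add,
    Finset.sum_add_distrib, mul_assoc]

theorem eval_zero_lineMap (w : Module.Dual k V) (p : MvPolynomial (Fin r) k) :
    (lineMap b w p).eval 0 = p := by
  induction p using MvPolynomial.induction_on with
  | C c => rw [lineMap_C, Polynomial.eval_C]
  | add p q hp hq => rw [map_add, Polynomial.eval_add, hp, hq]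
  | mul_X p i hp => rw [map_mul, Polynomial.eval_mul, hp, lineMap_X]; simp

theorem lineMap_injective (w : Module.Dual k V) : Function.Injective (lineMap b w) :=
  Function.LeftInverse.injective (g := Polynomial.eval 0) (eval_zero_lineMap b w)

/-- The derivative of polynomials in the direction `w`. -/
def polyDeriv (w : Module.Dual k V) (p : MvPolynomial (Fin r) k) : MvPolynomial (Fin r) k :=
  (lineMap b w p).derivative.eval 0

theorem polyDeriv_C (w : Module.Dual k V) (c : k) : polyDeriv b w (MvPolynomial.C c) = 0 := by
  rw [polyDeriv, lineMap_C, Polynomial.derivative_C, Polynomial.eval_zero]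

theorem polyDeriv_X (w : Module.Dual k V) (i : Fin r) :
    polyDeriv b w (MvPolynomial.X i) = MvPolynomial.C (w (b i)) := by
  simp [polyDeriv, lineMap_X]

theorem polyDeriv_add (w : Module.Dual k V) (p q : MvPolynomial (Fin r) k) :
    polyDeriv b w (p + q) = polyDeriv b w p + polyDeriv b w q := by
  simp only [polyDeriv, map_add, Polynomial.eval_add]

theorem polyDeriv_mul (w : Module.Dual k V) (p q : MvPolynomial (Fin r) k) :
    polyDeriv b w (p * q) = polyDeriv b w p * q + p * polyDeriv b w q := by
  simp only [polyDeriv, map_mul, Polynomial.derivative_mul, Polynomial.eval_add,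
    Polynomial.eval_mul, eval_zero_lineMap]

/-- Turns derivatives in the direction `w` into ordinary derivatives in the parameter `t`, so that
one-variable degree arguments apply. -/
theorem lineMap_polyDeriv (w : Module.Dual k V) (p : MvPolynomial (Fin r) k) :
    lineMap b w (polyDeriv b w p) = (lineMap b w p).derivative := by
  induction p using MvPolynomial.induction_on with
  | C c => rw [polyDeriv_C, lineMap_C, Polynomial.derivative_C, map_zero]
  | add p q hp hq => rw [polyDeriv_add, map_add, map_add, Polynomial.derivative_add, hp, hq]
  | mul_X p i hp =>
    have hX : (lineMap b w (MvPolynomial.X i)).derivative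
        = Polynomial.C (MvPolynomial.C (w (b i))) := by simp [lineMap_X]
    rw [polyDeriv_mul, map_add, map_mul, map_mul, map_mul, Polynomial.derivative_mul, hp,
      polyDeriv_X, hX, lineMap_C]

theorem dirDeriv_algebraMap (w : Module.Dual k V) (p : MvPolynomial (Fin r) k) :
    dirDeriv b Δ w (algebraMap _ _ p) = algebraMap _ _ (polyDeriv b w p) := by
  induction p using MvPolynomial.induction_on with
  | C c =>
    rw [polyDeriv_C, map_zero, ← MvPolynomial.algebraMap_eq, ← IsScalarTower.algebraMap_apply,
      Derivation.map_algebraMap]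
  | add p q hp hq => rw [polyDeriv_add, map_add, map_add, map_add, hp, hq]
  | mul_X p i hp =>
    have hX : dirDeriv b Δ w (algebraMap (MvPolynomial (Fin r) k) _ (MvPolynomial.X i))
        = algebraMap (MvPolynomial (Fin r) k) _ (MvPolynomial.C (w (b i))) := by
      have := dirDeriv_linR b Δ w (b i)
      rw [linR_apply, linForm_basis] at this
      rw [this, ← MvPolynomial.algebraMap_eq, ← IsScalarTower.algebraMap_apply]
    rw [map_mul, Derivation.leibniz, hp, hX, polyDeriv_mul, polyDeriv_X, map_add, map_mul, map_mul,
      smul_eq_mul, smul_eq_mul]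
    ring

/-- On lines of direction `w` a polynomial has finite degree in `t`, so enough derivatives kill it;
injectivity of `lineMap` brings this back. -/
theorem dirDeriv_iterate_algebraMap (w : Module.Dual k V) (p : MvPolynomial (Fin r) k) :
    ∃ N, (dirDeriv b Δ w)^[N] (algebraMap _ _ p) = 0 := by
  refine ⟨(lineMap b w p).natDegree + 1, ?_⟩
  have h1 : ∀ N, (dirDeriv b Δ w)^[N] (algebraMap _ _ p)
      = algebraMap _ _ ((polyDeriv b w)^[N] p) := by
    intro N
    induction N with
    | zero => rfl
    | succ N ih =>
      rw [Function.iterate_succ_apply', Function.iterate_succ_apply', ih, dirDeriv_algebraMap]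
  have h2 : ∀ N, lineMap b w ((polyDeriv b w)^[N] p)
      = Polynomial.derivative^[N] (lineMap b w p) := by
    intro N
    induction N with
    | zero => rfl
    | succ N ih =>
      rw [Function.iterate_succ_apply', Function.iterate_succ_apply', lineMap_polyDeriv, ih]
  have h3 := h2 ((lineMap b w p).natDegree + 1)
  rw [Polynomial.iterate_derivative_eq_zero (Nat.lt_succ_self _), ← map_zero (lineMap b w)] at h3
  rw [h1, lineMap_injective b w h3, map_zero]

/-- The hypothesis says that `p / q` has zero derivative. Comparing coefficients in degree `deg p +
deg q - 1` gives `deg q = deg p` after cancelling the leading coefficients, which is excluded. -/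
theorem eq_zero_of_derivative_mul_eq {A : Type*} [CommRing A] [IsDomain A] [CharZero A]
    {p q : Polynomial A} (hdeg : p.natDegree < q.natDegree)
    (h : p * q.derivative = p.derivative * q) : p = 0 := by
  by_contra hp
  have hq : q ≠ 0 := by rintro rfl; simp at hdeg
  have hp' := Polynomial.leadingCoeff_ne_zero.2 hp
  have hq' := Polynomial.leadingCoeff_ne_zero.2 hq
  obtain ⟨n, hn⟩ : ∃ n, q.natDegree = n + 1 := ⟨q.natDegree - 1, by omega⟩
  have hqd : q.derivative.natDegree ≤ n := (Polynomial.natDegree_derivative_le q).trans (by omega)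
  have h1 : (p * q.derivative).coeff (p.natDegree + n)
      = p.leadingCoeff * (q.leadingCoeff * (n + 1)) := by
    rw [Polynomial.coeff_mul_add_eq_of_natDegree_le le_rfl hqd, Polynomial.coeff_derivative, ← hn]
    rfl
  rw [h] at h1
  rcases hm : p.natDegree with _ | m
  · rw [Polynomial.eq_C_of_natDegree_eq_zero hm, Polynomial.derivative_C, zero_mul,
      Polynomial.coeff_zero, ← Polynomial.eq_C_of_natDegree_eq_zero hm] at h1
    exact mul_ne_zero hp' (mul_ne_zero hq' (Nat.cast_add_one_ne_zero n)) h1.symm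
  · have hpd : p.derivative.natDegree ≤ m :=
      (Polynomial.natDegree_derivative_le p).trans (by omega)
    rw [hm, show m + 1 + n = m + (n + 1) by ring, ← hn,
      Polynomial.coeff_mul_add_eq_of_natDegree_le hpd le_rfl, Polynomial.coeff_derivative, ← hm,
      Polynomial.coeff_natDegree, Polynomial.coeff_natDegree] at h1
    have h2 : p.leadingCoeff * q.leadingCoeff * ((m : A) + 1)
        = p.leadingCoeff * q.leadingCoeff * ((n : A) + 1) := by linear_combination h1
    have h3 := mul_left_cancel₀ (mul_ne_zero hp' hq') h2
    have h4 : m + 1 = n + 1 := by exact_mod_cast h3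
    omega

variable {Δ}

/-- Decay in the direction `w`: a generating `κ` contains some `α` with `w α ≠ 0`, so the
denominator has positive degree in `t`. Stated as an inequality of degrees, the property survives
sums, through a common denominator. -/
theorem exists_rep_degree_lt (hΔ₀ : ∀ α ∈ Δ, α ≠ 0) {w : Module.Dual k V} (hw : w ≠ 0)
    {x : RDelta b Δ} (hx : x ∈ G b Δ) : ∃ (p : MvPolynomial (Fin r) k) (d : denoms b Δ),
      x * algebraMap _ _ (d : MvPolynomial (Fin r) k) = algebraMap _ _ p ∧
        (lineMap b w p).degree < (lineMap b w d).degree := by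
  have hd0 : ∀ d : denoms b Δ, lineMap b w d ≠ 0 := fun d h =>
    denoms_ne_zero b hΔ₀ d (lineMap_injective b w (by rw [h, map_zero]))
  unfold G at hx
  induction hx using Submodule.span_induction with
  | zero =>
    refine ⟨0, 1, by simp, ?_⟩
    rw [map_zero, Polynomial.degree_zero, bot_lt_iff_ne_bot, Ne, Polynomial.degree_eq_bot]
    exact hd0 1
  | add x y _ _ hx hy =>
    obtain ⟨p, d, h1, h2⟩ := hx
    obtain ⟨q, e, h3, h4⟩ := hy
    refine ⟨p * (e : MvPolynomial (Fin r) k) + q * (d : MvPolynomial (Fin r) k), d * e, ?_, ?_⟩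
    · rw [map_add, map_mul, map_mul, ← h1, ← h3, Submonoid.coe_mul, map_mul]; ring
    · rw [map_add, map_mul, map_mul, Submonoid.coe_mul, map_mul]
      refine (Polynomial.degree_add_le _ _).trans_lt (max_lt ?_ ?_)
      · rw [Polynomial.degree_mul, Polynomial.degree_mul]
        exact WithBot.add_lt_add_right (by simpa using hd0 e) h2
      · rw [Polynomial.degree_mul, Polynomial.degree_mul, add_comm]
        exact WithBot.add_lt_add_left (by simpa using hd0 d) h4
  | smul c x _ hx =>
    obtain ⟨p, d, h1, h2⟩ := hx
    refine ⟨c • p, d, ?_, ?_⟩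
    · rw [smul_mul_assoc, h1]
      exact (map_smul (IsScalarTower.toAlgHom k (MvPolynomial (Fin r) k) (RDelta b Δ)) c p).symm
    · rw [map_smul]
      exact (Polynomial.degree_smul_le _ _).trans_lt h2
  | mem x hx =>
    classical
    obtain ⟨κ, n, hκ, hn, rfl⟩ := hx
    refine ⟨1, ∏ α ∈ κ, den b Δ α ^ n α, ?_, ?_⟩
    · rw [Localization.mk_eq_mk', IsLocalization.mk'_spec]
    obtain ⟨α, hα, hwα⟩ : ∃ α ∈ κ, w (α : V) ≠ 0 := by
      by_contra! h
      refine hw (LinearMap.ext_on (show Submodule.span k _ = ⊤ from hκ) ?_)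
      rintro _ ⟨α, hα, rfl⟩
      exact h α hα
    rw [map_one, Polynomial.degree_one, ← Polynomial.natDegree_pos_iff_degree_pos,
      Submonoid.coe_finsetProd, map_prod, Polynomial.natDegree_prod]
    · refine Finset.sum_pos' (fun _ _ => Nat.zero_le _) ⟨α, hα, ?_⟩
      rw [SubmonoidClass.coe_pow, map_pow, Polynomial.natDegree_pow]
      refine Nat.mul_pos (hn α hα) ?_
      rw [show ((den b Δ α : denoms b Δ) : MvPolynomial (Fin r) k) = linForm b α from rfl,
        lineMap_linForm, add_comm, Polynomial.natDegree_add_C, Polynomial.natDegree_C_mul_X]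
      · exact one_pos
      · simpa using hwα
    · exact fun α _ => hd0 _

/-- A rational function that is constant in the direction `w` and decays in that direction is zero.
-/
theorem eq_zero_of_dirDeriv_eq_zero [CharZero k] (hΔ₀ : ∀ α ∈ Δ, α ≠ 0) {w : Module.Dual k V}
    (hw : w ≠ 0) {x : RDelta b Δ} (hx : x ∈ G b Δ) (h0 : dirDeriv b Δ w x = 0) : x = 0 := by
  obtain ⟨p, d, h1, h2⟩ := exists_rep_degree_lt b hΔ₀ hw hx
  suffices hp : p = 0 by
    rw [hp, map_zero] at h1
    exact (IsLocalization.map_units (RDelta b Δ) d).mul_left_eq_zero.1 h1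
  apply lineMap_injective b w
  rw [map_zero]
  by_contra hne
  refine hne (eq_zero_of_derivative_mul_eq
    ((Polynomial.natDegree_lt_natDegree_iff hne).2 h2) (q := lineMap b w d) ?_)
  rw [← lineMap_polyDeriv, ← lineMap_polyDeriv, ← map_mul, ← map_mul]
  congr 1
  apply algebraMap_injective b hΔ₀
  -- Differentiating `x d = p` with `x` constant along `w` gives `x d' = p'`, hence `p d' = p' d`.
  have h3 := congrArg (dirDeriv b Δ w) h1
  rw [Derivation.leibniz, h0, smul_zero, add_zero, dirDeriv_algebraMap, dirDeriv_algebraMap,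
    smul_eq_mul] at h3
  rw [map_mul, map_mul, ← h3, ← h1]
  ring

theorem exists_dual_of_not_generating {κ : Finset Δ} (hκ : ¬ Generating k κ) :
    ∃ w : Module.Dual k V, w ≠ 0 ∧ ∀ α ∈ κ, w (α : V) = 0 := by
  obtain ⟨w, hw, h⟩ := Submodule.exists_le_ker_of_lt_top _ (lt_top_iff_ne_top.2 hκ)
  exact ⟨w, hw, fun α hα => h (Submodule.subset_span ⟨α, hα, rfl⟩)⟩

/-- For a generator `ψ / ∏_{α ∈ κ} α ^ n_α` choose `w ≠ 0` vanishing on `κ`: the derivative along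
`w` acts only on `ψ`, so a power of it annihilates the generator, while each derivative is injective
on `G`. For sums, the operators are multiplied. -/
theorem exists_diffHom_eq_zero [CharZero k] (hΔ₀ : ∀ α ∈ Δ, α ≠ 0) {x : RDelta b Δ}
    (hx : x ∈ NG b Δ) : ∃ P : MvPolynomial (Fin r) k, diffHom b Δ P x = 0 ∧
      ∀ y ∈ G b Δ, diffHom b Δ P y = 0 → y = 0 := by
  -- Stability of `G` is added so that injectivity on `G` passes to compositions.
  suffices h : ∃ P : MvPolynomial (Fin r) k, diffHom b Δ P x = 0 ∧
      ∀ y ∈ G b Δ, diffHom b Δ P y ∈ G b Δ ∧ (diffHom b Δ P y = 0 → y = 0) by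
    obtain ⟨P, h1, h2⟩ := h
    exact ⟨P, h1, fun y hy => (h2 y hy).2⟩
  unfold NG at hx
  induction hx using Submodule.span_induction with
  | zero => exact ⟨1, map_zero _, fun y hy => by simpa using hy⟩
  | add x y _ _ hx hy =>
    obtain ⟨P, h1, h2⟩ := hx
    obtain ⟨Q, h3, h4⟩ := hy
    refine ⟨P * Q, ?_, fun y hy => ?_⟩
    · have hx : diffHom b Δ (P * Q) x = 0 := by
        rw [mul_comm, map_mul, Module.End.mul_apply, h1, map_zero]
      have hy : diffHom b Δ (P * Q) y = 0 := by
        rw [map_mul, Module.End.mul_apply, h3, map_zero]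
      rw [map_add, hx, hy, add_zero]
    · rw [map_mul, Module.End.mul_apply]
      exact ⟨(h2 _ (h4 y hy).1).1, fun h => (h4 y hy).2 ((h2 _ (h4 y hy).1).2 h)⟩
  | smul c x _ hx =>
    obtain ⟨P, h1, h2⟩ := hx
    exact ⟨P, by rw [map_smul, h1, smul_zero], h2⟩
  | mem x hx =>
    obtain ⟨κ, n, ψ, hκ, rfl⟩ := hx
    obtain ⟨w, hw, hwκ⟩ := exists_dual_of_not_generating hκ
    obtain ⟨N, hN⟩ := dirDeriv_iterate_algebraMap b Δ w ψ
    have hpow : ∀ (N : ℕ) (y : RDelta b Δ),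
        diffHom b Δ (dualForm b w ^ N) y = (dirDeriv b Δ w)^[N] y := by
      intro N y
      induction N with
      | zero => simp
      | succ N ih =>
        rw [pow_succ', map_mul, Module.End.mul_apply, ih, diffHom_dualForm,
          Function.iterate_succ_apply']
    refine ⟨dualForm b w ^ N, ?_, fun y hy => ?_⟩
    · have h0 : dirDeriv b Δ w (∏ α ∈ κ, invR b Δ α ^ n α) = 0 := by
        rw [dirDeriv_prod_invR]
        exact Finset.sum_eq_zero fun α hα => by rw [hwκ α hα, mul_zero, neg_zero, zero_smul]
      have h1 : ∀ N, (dirDeriv b Δ w)^[N] (algebraMap _ _ ψ * ∏ α ∈ κ, invR b Δ α ^ n α)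
          = (dirDeriv b Δ w)^[N] (algebraMap _ _ ψ) * ∏ α ∈ κ, invR b Δ α ^ n α := by
        intro N
        induction N with
        | zero => rfl
        | succ N ih =>
          rw [Function.iterate_succ_apply', Function.iterate_succ_apply', ih, Derivation.leibniz,
            h0, smul_zero, zero_add, smul_eq_mul, mul_comm]
      rw [hpow, mk_prod, h1, hN, zero_mul]
    · rw [hpow]
      clear hN
      induction N with
      | zero => exact ⟨hy, id⟩
      | succ N ih =>
        rw [Function.iterate_succ_apply']
        exact ⟨dirDeriv_mem_G b Δ w ih.1,
          fun h => ih.2 (eq_zero_of_dirDeriv_eq_zero b hΔ₀ hw ih.1 h)⟩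

/-- `R_Δ = G_Δ ⊕ NG_Δ`. -/
theorem isCompl_G_NG [CharZero k] (hΔ₀ : ∀ α ∈ Δ, α ≠ 0) : IsCompl (G b Δ) (NG b Δ) := by
  constructor
  · rw [Submodule.disjoint_def]
    intro x hG hNG
    obtain ⟨P, h1, h2⟩ := exists_diffHom_eq_zero b hΔ₀ hNG
    exact h2 x hG h1
  · rw [codisjoint_iff, sup_comm, eq_top_iff, ← NG_sup_basicFractions]
    exact sup_le_sup_left (basicFractions_le_G b Δ _) _

variable (Δ)

/-! ### Taylor expansions and residues -/

/-- The natural map `Ŝ(V) → R̂_Δ`. -/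
def ofSeries : MvPowerSeries (Fin r) k →ₐ[k] RDeltaHat b Δ :=
  IsScalarTower.toAlgHom k (MvPowerSeries (Fin r) k) (RDeltaHat b Δ)

theorem ofSeries_apply (p : MvPowerSeries (Fin r) k) :
    ofSeries b Δ p = algebraMap _ _ p := rfl

theorem toHat_algebraMap' (p : MvPolynomial (Fin r) k) :
    toHat b Δ (algebraMap _ _ p) = ofSeries b Δ (p : MvPowerSeries (Fin r) k) :=
  toHat_algebraMap b Δ p

theorem taylor_ofSeries_mul_toHat (K : ℤ) (p : MvPowerSeries (Fin r) k)
    (ψ : MvPolynomial (Fin r) k) (d : denoms b Δ) :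
    taylor b Δ K (ofSeries b Δ p * toHat b Δ (Localization.mk ψ d))
      = Localization.mk (MvPowerSeries.truncTotal
        (K + ((d : MvPolynomial (Fin r) k).totalDegree : ℤ) + 1).toNat
          (p * (ψ : MvPowerSeries (Fin r) k))) d := by
  refine taylorFun_eq b Δ K _ _ _ ?_
  rw [map_mul, ← toHat_algebraMap, ← toHat_algebraMap, ofSeries_apply, mul_assoc, ← map_mul,
    Localization.mk_eq_mk', IsLocalization.mk'_spec]

/-- Multiplication by `p` and truncation change only the numerator; the non-generating denominator
is kept. -/
theorem taylor_mem_NG (K : ℤ) (p : MvPowerSeries (Fin r) k) {x : RDelta b Δ}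
    (hx : x ∈ NG b Δ) : taylor b Δ K (ofSeries b Δ p * toHat b Δ x) ∈ NG b Δ := by
  unfold NG at hx
  induction hx using Submodule.span_induction with
  | zero => rw [map_zero, mul_zero, map_zero]; exact zero_mem _
  | add x y _ _ hx hy => rw [map_add, mul_add, map_add]; exact add_mem hx hy
  | smul c x _ hx => rw [map_smul, mul_smul_comm, map_smul]; exact Submodule.smul_mem _ c hx
  | mem x hx =>
    obtain ⟨κ, n, ψ, hκ, rfl⟩ := hx
    rw [taylor_ofSeries_mul_toHat]
    exact Submodule.subset_span ⟨κ, n, _, hκ, rfl⟩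

-- Multiplication by a power series cannot lower the order of the numerator, so a vanishing
-- truncation remains zero.
variable {b Δ} in
theorem taylor_mul_eq_zero (K : ℤ) (φ : RDeltaHat b Δ) (p f : MvPowerSeries (Fin r) k)
    (d : denoms b Δ)
    (h : φ * algebraMap _ _ ((d : MvPolynomial (Fin r) k) : MvPowerSeries (Fin r) k)
        = algebraMap _ _ f)
    (hf : MvPowerSeries.truncTotal
      (K + ((d : MvPolynomial (Fin r) k).totalDegree : ℤ) + 1).toNat f = 0) :
    taylor b Δ K (ofSeries b Δ p * φ) = 0 := by
  have h1 : ofSeries b Δ p * φ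
      * algebraMap _ _ ((d : MvPolynomial (Fin r) k) : MvPowerSeries (Fin r) k)
        = algebraMap _ _ (p * f) := by
    rw [mul_assoc, h, map_mul, ofSeries_apply]
  change taylorFun b Δ K _ = 0
  rw [taylorFun_eq b Δ K _ _ _ h1]
  generalize (K + ((d : MvPolynomial (Fin r) k).totalDegree : ℤ) + 1).toNat = N at hf
  suffices h2 : MvPowerSeries.truncTotal N (p * f) = 0 by rw [h2, Localization.mk_zero]
  ext m
  rw [MvPowerSeries.coeff_truncTotal_eq_ite, MvPolynomial.coeff_zero]
  split_ifs with hm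
  · rw [MvPowerSeries.coeff_mul]
    refine Finset.sum_eq_zero fun x hx => ?_
    have h3 : x.2.degree < N := by
      have := congrArg Finsupp.degree (Finset.HasAntidiagonal.mem_antidiagonal.1 hx)
      rw [map_add] at this
      omega
    rw [← MvPowerSeries.coeff_truncTotal f h3, hf, MvPolynomial.coeff_zero, mul_zero]
  · rfl

variable {b Δ} in
theorem princ_ofSeries_mul_toHat_eq_zero (h : IsCompl (G b Δ) (NG b Δ))
    (p : MvPowerSeries (Fin r) k) {x : RDelta b Δ} (hx : x ∈ NG b Δ) :
    princ b Δ h (ofSeries b Δ p * toHat b Δ x) = 0 := by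
  rw [princ, LinearMap.comp_apply, Submodule.projectionOnto_apply_eq_zero_iff]
  exact taylor_mem_NG b Δ _ p hx

variable {b Δ} in
theorem res_ofSeries_mul_toHat_eq_zero (h : IsCompl (G b Δ) (NG b Δ))
    (p : MvPowerSeries (Fin r) k) {x : RDelta b Δ} (hx : x ∈ NG b Δ) :
    res b Δ h (ofSeries b Δ p * toHat b Δ x) = 0 := by
  rw [res, LinearMap.comp_apply, princ_ofSeries_mul_toHat_eq_zero h p hx, map_zero]

/-- A basis of `Δ` as a basis of `V`. -/
def IsBasis.basis {Δ : Finset V} {σ : Finset Δ} (hσ : IsBasis k σ) : Module.Basis σ k V :=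
  Module.Basis.mk (v := fun α : σ => ((α : Δ) : V)) hσ.1 (by
    rw [← show Submodule.span k ((fun α : Δ => (α : V)) '' (σ : Set Δ)) = ⊤ from hσ.2,
      Set.image_eq_range]
    exact le_rfl)

theorem IsBasis.basis_apply {Δ : Finset V} {σ : Finset Δ} (hσ : IsBasis k σ) (α : σ) :
    hσ.basis α = ((α : Δ) : V) :=
  Module.Basis.mk_apply _ _ α

theorem IsBasis.card_eq (b : Module.Basis (Fin r) k V) {Δ : Finset V} {σ : Finset Δ}
    (hσ : IsBasis k σ) : σ.card = r := by
  have h1 : Module.finrank k V = r := by simpa using Module.finrank_eq_card_basis b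
  rw [← h1, Module.finrank_eq_card_basis hσ.basis, Fintype.card_coe]

/-- The element `φ_σ = 1 / ∏_{α ∈ σ} α` of `S_Δ`. -/
def basicS {Δ : Finset V} {σ : Finset Δ} (hσ : IsBasis k σ) : S b Δ :=
  ⟨∏ α ∈ σ, invR b Δ α, prod_invR_mem_S b Δ hσ⟩

variable {Δ}

theorem totalDegree_prod_den (hΔ₀ : ∀ α ∈ Δ, α ≠ 0) (σ : Finset Δ) (n : Δ → ℕ) :
    ((∏ α ∈ σ, den b Δ α ^ n α : denoms b Δ) : MvPolynomial (Fin r) k).totalDegree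
      = ∑ α ∈ σ, n α := by
  refine MvPolynomial.IsHomogeneous.totalDegree ?_ (denoms_ne_zero b hΔ₀ _)
  rw [Submonoid.coe_finsetProd]
  refine MvPolynomial.IsHomogeneous.prod _ _ _ fun α _ => ?_
  simpa [den] using (linForm_isHomogeneous b (α : V)).pow (n α)

/-- The fraction is homogeneous of degree `-∑ n_α`, so the Taylor expansion keeps it whole or
discards it. -/
theorem taylor_toHat_prod_invR (hΔ₀ : ∀ α ∈ Δ, α ≠ 0) (K : ℤ) (σ : Finset Δ) (n : Δ → ℕ) :
    taylor b Δ K (toHat b Δ (∏ α ∈ σ, invR b Δ α ^ n α))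
      = if 0 ≤ K + ∑ α ∈ σ, n α then ∏ α ∈ σ, invR b Δ α ^ n α else 0 := by
  have h := taylor_ofSeries_mul_toHat b Δ K 1 1 (∏ α ∈ σ, den b Δ α ^ n α)
  rw [map_one, one_mul, mk_one_prod, totalDegree_prod_den b hΔ₀, MvPolynomial.coe_one,
    mul_one] at h
  rw [h]
  split_ifs with hK
  · rw [MvPowerSeries.truncTotal_one (by omega), mk_one_prod]
  · have e : (K + ((∑ α ∈ σ, n α : ℕ) : ℤ) + 1).toNat = 0 := by omega
    have e3 : MvPowerSeries.truncTotal 0 (1 : MvPowerSeries (Fin r) k) = 0 := by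
      ext m; simp [MvPowerSeries.coeff_truncTotal_eq_ite]
    rw [e, e3, Localization.mk_zero]

theorem princ_toHat_prod_invR (hΔ₀ : ∀ α ∈ Δ, α ≠ 0) (h : IsCompl (G b Δ) (NG b Δ))
    {σ : Finset Δ} (hσ : IsBasis k σ) {n : Δ → ℕ} (hn : ∀ α ∈ σ, 0 < n α) :
    (princ b Δ h (toHat b Δ (∏ α ∈ σ, invR b Δ α ^ n α)) : RDelta b Δ)
      = ∏ α ∈ σ, invR b Δ α ^ n α := by
  have h1 : r ≤ ∑ α ∈ σ, n α := by
    rw [← hσ.card_eq b, Finset.card_eq_sum_ones]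
    exact Finset.sum_le_sum fun α hα => hn α hα
  rw [princ, LinearMap.comp_apply, taylor_toHat_prod_invR b hΔ₀, if_pos (by omega),
    Submodule.projectionOnto_apply_of_mem_left h (prod_invR_mem_G b Δ hσ.2 hn)]

/-- As `σ` has `r` elements and all `n_α ≥ 1`, the degree equals `-r` exactly when every exponent is
`1`. -/
theorem res_toHat_prod_invR (hΔ₀ : ∀ α ∈ Δ, α ≠ 0) (h : IsCompl (G b Δ) (NG b Δ))
    {σ : Finset Δ} (hσ : IsBasis k σ) {n : Δ → ℕ} (hn : ∀ α ∈ σ, 0 < n α)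
    [Decidable (∀ α ∈ σ, n α = 1)] :
    res b Δ h (toHat b Δ (∏ α ∈ σ, invR b Δ α ^ n α))
      = if ∀ α ∈ σ, n α = 1 then basicS b hσ else 0 := by
  have h1 : ∑ α ∈ σ, 1 ≤ ∑ α ∈ σ, n α := Finset.sum_le_sum fun α hα => hn α hα
  have h2 : ∑ α ∈ σ, 1 = r := by rw [← Finset.card_eq_sum_ones, hσ.card_eq b]
  apply Subtype.ext
  rw [res, LinearMap.comp_apply]
  change degPart b Δ (-r) (princ b Δ h _ : RDelta b Δ) = _
  rw [princ_toHat_prod_invR b hΔ₀ h hσ hn, degPart, LinearMap.comp_apply, LinearMap.sub_apply,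
    AlgHom.toLinearMap_apply, taylor_toHat_prod_invR b hΔ₀, taylor_toHat_prod_invR b hΔ₀,
    if_pos (by omega)]
  split_ifs with h4 h5 h5
  · rw [Finset.sum_congr rfl h5, h2] at h4
    exfalso
    omega
  · rw [sub_self]; rfl
  · rw [sub_zero]
    exact Finset.prod_congr rfl fun α hα => by rw [h5 α hα, pow_one]
  · refine absurd (fun α hα => ?_) h5
    have h6 : ∑ α ∈ σ, 1 = ∑ α ∈ σ, n α := by omega
    exact ((Finset.sum_eq_sum_iff_of_le fun α hα => hn α hα).1 h6 α hα).symm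

theorem toHat_linR (α : V) :
    toHat b Δ (linR b Δ α) = ofSeries b Δ (linForm b α : MvPowerSeries (Fin r) k) :=
  toHat_algebraMap b Δ _

theorem linR_pow_mul_invR_pow (α : Δ) {m n : ℕ} (h : m ≤ n) :
    linR b Δ α ^ m * invR b Δ α ^ n = invR b Δ α ^ (n - m) := by
  obtain ⟨l, rfl⟩ := Nat.exists_eq_add_of_le h
  rw [pow_add, ← mul_assoc, ← mul_pow, linR_mul_invR, one_pow, one_mul, Nat.add_sub_cancel_left]

/-- Multiples of `α ^ n_α` do not contribute to the residue. -/
theorem res_linForm_pow_mul (h : IsCompl (G b Δ) (NG b Δ)) {σ : Finset Δ} (hσ : IsBasis k σ)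
    (n : Δ → ℕ) {α : Δ} (hα : α ∈ σ) {m : ℕ} (hm : n α ≤ m) (q : MvPowerSeries (Fin r) k) :
    res b Δ h (ofSeries b Δ ((linForm b (α : V) : MvPowerSeries (Fin r) k) ^ m * q)
      * toHat b Δ (∏ β ∈ σ, invR b Δ β ^ n β)) = 0 := by
  classical
  obtain ⟨l, rfl⟩ := Nat.exists_eq_add_of_le hm
  have h1 : ofSeries b Δ ((linForm b (α : V) : MvPowerSeries (Fin r) k) ^ (n α + l) * q)
      * toHat b Δ (∏ β ∈ σ, invR b Δ β ^ n β)
      = ofSeries b Δ ((linForm b (α : V) : MvPowerSeries (Fin r) k) ^ l * q)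
        * toHat b Δ (∏ β ∈ σ.erase α, invR b Δ β ^ n β) := by
    rw [← Finset.mul_prod_erase _ _ hα]
    have h2 : ofSeries b Δ ((linForm b (α : V) : MvPowerSeries (Fin r) k) ^ n α)
        * toHat b Δ (invR b Δ α ^ n α) = 1 := by
      rw [map_pow, ← toHat_linR, ← map_pow, ← map_mul, ← mul_pow, linR_mul_invR, one_pow, map_one]
    rw [pow_add, map_mul, map_mul, map_mul, map_mul]
    linear_combination (ofSeries b Δ ((linForm b (α : V) : MvPowerSeries (Fin r) k) ^ l)
      * ofSeries b Δ q * toHat b Δ (∏ β ∈ σ.erase α, invR b Δ β ^ n β)) * h2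
  rw [h1]
  exact res_ofSeries_mul_toHat_eq_zero h _
    (prod_invR_mem_NG b Δ (not_generating_erase Δ hσ.1 hα) n)

/-- Cancellation leaves the exponents `n_α - m_α`. If one of them is not positive, the denominators
cease to generate; otherwise only degree `-r` contributes. Thus the residue extracts the coefficient
of `∏ α ^ (n_α - 1)`. -/
theorem res_prod_linForm_pow (hΔ₀ : ∀ α ∈ Δ, α ≠ 0) (h : IsCompl (G b Δ) (NG b Δ))
    {σ : Finset Δ} (hσ : IsBasis k σ) {n m : Δ → ℕ}
    [Decidable (∀ α ∈ σ, n α = m α + 1)] :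
    res b Δ h (ofSeries b Δ (∏ α ∈ σ, (linForm b (α : V) : MvPowerSeries (Fin r) k) ^ m α)
      * toHat b Δ (∏ α ∈ σ, invR b Δ α ^ n α))
      = if ∀ α ∈ σ, n α = m α + 1 then basicS b hσ else 0 := by
  classical
  by_cases hm : ∃ α ∈ σ, n α ≤ m α
  · obtain ⟨α, hα, hle⟩ := hm
    rw [if_neg (fun h => by have := h α hα; omega), ← Finset.mul_prod_erase _ _ hα]
    exact res_linForm_pow_mul b h hσ n hα hle _
  · push Not at hm
    have h1 : ofSeries b Δ (∏ α ∈ σ, (linForm b (α : V) : MvPowerSeries (Fin r) k) ^ m α)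
        * toHat b Δ (∏ α ∈ σ, invR b Δ α ^ n α)
        = toHat b Δ (∏ α ∈ σ, invR b Δ α ^ (n α - m α)) := by
      rw [map_prod]
      simp only [map_pow, ← toHat_linR]
      simp only [← map_pow]
      rw [← map_prod, ← map_mul, ← Finset.prod_mul_distrib]
      congr 1
      exact Finset.prod_congr rfl fun α hα => linR_pow_mul_invR_pow b α (hm α hα).le
    rw [h1, res_toHat_prod_invR b hΔ₀ h hσ (fun α hα => Nat.sub_pos_of_lt (hm α hα))]
    refine if_congr (forall₂_congr fun α hα => ?_) rfl rfl
    have := hm α hα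
    omega

/-! ### Residues of multiples of a basic fraction -/

/-- The map `p ↦ Res_Δ (p ∏_{α ∈ σ} α ^ (-n_α))` on power series. -/
def fracRes (h : IsCompl (G b Δ) (NG b Δ)) (σ : Finset Δ) (n : Δ → ℕ) :
    MvPowerSeries (Fin r) k →ₗ[k] S b Δ :=
  res b Δ h ∘ₗ LinearMap.mulRight k (toHat b Δ (∏ α ∈ σ, invR b Δ α ^ n α)) ∘ₗ
    (ofSeries b Δ).toLinearMap

theorem fracRes_apply (h : IsCompl (G b Δ) (NG b Δ)) (σ : Finset Δ) (n : Δ → ℕ)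
    (p : MvPowerSeries (Fin r) k) : fracRes b h σ n p
      = res b Δ h (ofSeries b Δ p * toHat b Δ (∏ α ∈ σ, invR b Δ α ^ n α)) := rfl

/-- A vector as a power series. -/
def linSeries (α : V) : MvPowerSeries (Fin r) k := (linForm b α : MvPowerSeries (Fin r) k)

theorem fracRes_linSeries_pow_mul (h : IsCompl (G b Δ) (NG b Δ)) {σ : Finset Δ}
    (hσ : IsBasis k σ) {n : Δ → ℕ} {α : Δ} (hα : α ∈ σ) {m : ℕ} (hm : n α ≤ m)
    (q : MvPowerSeries (Fin r) k) : fracRes b h σ n (linSeries b α ^ m * q) = 0 :=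
  res_linForm_pow_mul b h hσ n hα hm q

theorem fracRes_prod_linSeries_pow (hΔ₀ : ∀ α ∈ Δ, α ≠ 0) (h : IsCompl (G b Δ) (NG b Δ))
    {σ : Finset Δ} (hσ : IsBasis k σ) {n m : Δ → ℕ} [Decidable (∀ α ∈ σ, n α = m α + 1)] :
    fracRes b h σ n (∏ α ∈ σ, linSeries b (α : V) ^ m α)
      = if ∀ α ∈ σ, n α = m α + 1 then basicS b hσ else 0 :=
  res_prod_linForm_pow b hΔ₀ h hσ

theorem C_mul_eq_smul (c : k) (p : MvPowerSeries (Fin r) k) : MvPowerSeries.C c * p = c • p :=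
  (MvPowerSeries.smul_eq_C_mul p c).symm

/-- When each factor is a series in its own variable `α`, modulo `α ^ n_α`, coefficient extraction
is multiplicative. -/
theorem fracRes_prod (hΔ₀ : ∀ α ∈ Δ, α ≠ 0) (h : IsCompl (G b Δ) (NG b Δ)) {σ : Finset Δ}
    (hσ : IsBasis k σ) {n : Δ → ℕ} (hn : ∀ α ∈ σ, 0 < n α) (p q : Δ → MvPowerSeries (Fin r) k)
    (a : Δ → ℕ → k)
    (hp : ∀ α ∈ σ, p α = ∑ j ∈ Finset.range (n α), a α j • linSeries b (α : V) ^ j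
      + linSeries b (α : V) ^ n α * q α) :
    fracRes b h σ n (∏ α ∈ σ, p α) = (∏ α ∈ σ, a α (n α - 1)) • basicS b hσ := by
  classical
  set P : Δ → MvPowerSeries (Fin r) k := fun α =>
    ∑ j ∈ Finset.range (n α), a α j • linSeries b (α : V) ^ j with hP
  -- Factors are replaced by their truncations one at a time; the spectator `u` absorbs all the
  -- others.
  have key : ∀ s ⊆ σ, ∀ u, fracRes b h σ n ((∏ α ∈ s, p α) * u)
      = fracRes b h σ n ((∏ α ∈ s, P α) * u) := by
    intro s
    induction s using Finset.induction_on with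
    | empty => intro _ _; rfl
    | insert α s hα ih =>
      intro hs u
      have hασ := hs (Finset.mem_insert_self α s)
      rw [Finset.prod_insert hα, Finset.prod_insert hα, mul_comm (p α), mul_assoc,
        ih ((Finset.subset_insert α s).trans hs), hp α hασ,
        show (∏ α ∈ s, P α) * ((∑ j ∈ Finset.range (n α), a α j • linSeries b (α : V) ^ j
          + linSeries b (α : V) ^ n α * q α) * u)
          = P α * (∏ α ∈ s, P α) * u
            + linSeries b (α : V) ^ n α * (q α * u * ∏ α ∈ s, P α) by rw [hP]; ring,
        map_add, fracRes_linSeries_pow_mul b h hσ hασ le_rfl, add_zero]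
  have key' := key σ subset_rfl 1
  rw [mul_one, mul_one] at key'
  rw [key', hP, Finset.prod_sum, map_sum]
  have hterm : ∀ g ∈ σ.pi fun α => Finset.range (n α),
      fracRes b h σ n (∏ x ∈ σ.attach, a x.1 (g x.1 x.2) • linSeries b (x.1 : V) ^ g x.1 x.2)
        = (∏ x ∈ σ.attach, a x.1 (g x.1 x.2)) •
          if ∀ α (hα : α ∈ σ), n α = g α hα + 1 then basicS b hσ else 0 := by
    intro g _
    -- Expanding the product yields exponents defined only on `σ`; they are extended by zero.
    set m : Δ → ℕ := fun α => if hα : α ∈ σ then g α hα else 0 with hm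
    have hmg : ∀ α (hα : α ∈ σ), m α = g α hα := fun α hα => by rw [hm]; simp only [dif_pos hα]
    have h1 : ∏ x ∈ σ.attach, linSeries b (x.1 : V) ^ g x.1 x.2
        = ∏ α ∈ σ, linSeries b (α : V) ^ m α := by
      rw [← Finset.prod_attach σ]
      exact Finset.prod_congr rfl fun x _ => by rw [hmg x.1 x.2]
    rw [Finset.prod_smul, map_smul, h1, fracRes_prod_linSeries_pow b hΔ₀ h hσ]
    congr 1
    exact if_congr (forall₂_congr fun α hα => by rw [hmg α hα]) rfl rfl
  rw [Finset.sum_congr rfl hterm, Finset.sum_eq_single fun α _ => n α - 1]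
  · rw [if_pos fun α hα => (Nat.sub_add_cancel (hn α hα)).symm,
      Finset.prod_attach σ fun α => a α (n α - 1)]
  · intro g _ hg
    rw [if_neg, smul_zero]
    intro h1
    refine hg (funext fun α => funext fun hα => ?_)
    have := h1 α hα
    omega
  · intro h1
    refine absurd (Finset.mem_pi.2 fun α hα => ?_) h1
    have := hn α hα
    rw [Finset.mem_range]; omega

/-- Only a polynomial truncation of `p` matters, and a polynomial times the fraction decomposes into
`NG` and basic fractions on the same `σ`, whose residues are multiples of `φ_σ`. -/
theorem fracRes_mem_span (hΔ₀ : ∀ α ∈ Δ, α ≠ 0) (h : IsCompl (G b Δ) (NG b Δ)) {σ : Finset Δ}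
    (hσ : IsBasis k σ) {n : Δ → ℕ} (hn : ∀ α ∈ σ, 0 < n α) (p : MvPowerSeries (Fin r) k) :
    fracRes b h σ n p ∈ Submodule.span k {basicS b hσ} := by
  classical
  set d : denoms b Δ := ∏ α ∈ σ, den b Δ α ^ n α with hd
  set q := MvPowerSeries.truncTotal
    (-(r : ℤ) + ((d : MvPolynomial (Fin r) k).totalDegree : ℤ) + 1).toNat p with hq
  have h1 : fracRes b h σ n p = fracRes b h σ n (q : MvPowerSeries (Fin r) k) := by
    have ht : taylor b Δ (-r) (ofSeries b Δ p * toHat b Δ (Localization.mk 1 d))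
        = taylor b Δ (-r) (ofSeries b Δ (q : MvPowerSeries (Fin r) k)
          * toHat b Δ (Localization.mk 1 d)) := by
      rw [taylor_ofSeries_mul_toHat, taylor_ofSeries_mul_toHat, MvPolynomial.coe_one, mul_one,
        mul_one]
      congr 1
      ext m
      rw [MvPowerSeries.coeff_truncTotal_eq_ite, MvPowerSeries.coeff_truncTotal_eq_ite,
        MvPolynomial.coeff_coe, hq, MvPowerSeries.coeff_truncTotal_eq_ite]
      split_ifs <;> rfl
    rw [hd, mk_one_prod] at ht
    rw [fracRes_apply, fracRes_apply, res, LinearMap.comp_apply, LinearMap.comp_apply, princ,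
      LinearMap.comp_apply, LinearMap.comp_apply, ht]
  rw [h1, fracRes_apply, ← toHat_algebraMap', ← map_mul]
  have h2 := algebraMap_mul_mem_basicFractions_sup b Δ (𝒮 := {σ}) q
    (Submodule.mem_sup_right (Submodule.subset_span ⟨σ, rfl, n, hσ, hn, rfl⟩))
  obtain ⟨x, hx, y, hy, hxy⟩ := Submodule.mem_sup.1 h2
  rw [← hxy, map_add, map_add]
  refine add_mem ?_ ?_
  · have := res_ofSeries_mul_toHat_eq_zero h 1 hx
    rw [map_one, one_mul] at this
    rw [this]
    exact zero_mem _
  clear h2 hxy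
  unfold basicFractions at hy
  induction hy using Submodule.span_induction with
  | zero => rw [map_zero, map_zero]; exact zero_mem _
  | add x y _ _ hx hy => rw [map_add, map_add]; exact add_mem hx hy
  | smul c x _ hx => rw [map_smul, map_smul]; exact Submodule.smul_mem _ c hx
  | mem x hx =>
    obtain ⟨_, rfl, m, _, hm, rfl⟩ := hx
    rw [res_toHat_prod_invR b hΔ₀ h hσ hm]
    split_ifs
    · exact Submodule.mem_span_singleton_self _
    · exact zero_mem _

/-- If `f v = 1`, then `T = (f ∘ T) ⊗ v` has rank at most one, and its trace is `f (T v) = c`. -/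
theorem trace_eq_of_forall_mem_span {M : Type*} [AddCommMonoid M] [Module k M] [Module.Finite k M]
    (T : M →ₗ[k] M) {v : M} (hv : v ≠ 0) (hT : ∀ x, T x ∈ Submodule.span k {v}) {c : k}
    (hc : T v = c • v) : LinearMap.trace k M T = c := by
  let : AddCommGroup M := Module.addCommMonoidToAddCommGroup k
  have : Module.Free k M := Module.Free.of_divisionRing k M
  obtain ⟨f, hf⟩ : ∃ f : Module.Dual k M, f v = 1 := by
    obtain ⟨f, hf⟩ := Module.Projective.exists_dual_ne_zero k hv
    exact ⟨(f v)⁻¹ • f, by simp [hf]⟩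
  have h1 : T = (f ∘ₗ T).smulRight v := by
    ext1 x
    obtain ⟨a, ha⟩ := Submodule.mem_span_singleton.1 (hT x)
    rw [LinearMap.smulRight_apply, LinearMap.comp_apply, ← ha, map_smul, hf, smul_eq_mul, mul_one]
  rw [h1, LinearMap.trace_smulRight, LinearMap.comp_apply, hc, map_smul, hf, smul_eq_mul, mul_one]

/-! ### The trace formula for basic fractions -/

theorem evalAt_linR (y : Module.Dual k V) (hy : Regular Δ y) (α : V) :
    evalAt b Δ y hy (linR b Δ α) = y α := by
  rw [linR_apply, evalAt, IsLocalization.coe_liftAlgHom, IsLocalization.lift_eq]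
  exact aeval_linForm b y α

theorem evalAt_invR (y : Module.Dual k V) (hy : Regular Δ y) (α : Δ) :
    evalAt b Δ y hy (invR b Δ α) = (y α)⁻¹ := by
  rw [← evalAt_linR b y hy]
  exact eq_inv_of_mul_eq_one_left (by rw [← map_mul, invR_mul_linR, map_one])

theorem reflect_linR (y : Module.Dual k V) (hy : Regular Δ y) (α : V) :
    reflect b Δ y hy (linR b Δ α) = MvPowerSeries.C (y α) - linSeries b α := by
  rw [linR_apply, reflect, IsLocalization.coe_liftAlgHom, IsLocalization.lift_eq]
  have h : y α = ∑ i, b.repr α i * y (b i) := by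
    conv_lhs => rw [← b.sum_repr α]
    simp only [map_sum, map_smul, smul_eq_mul]
  change MvPolynomial.aeval (fun i =>
    (MvPowerSeries.C (y (b i)) - MvPowerSeries.X i : MvPowerSeries (Fin r) k)) (linForm b α)
      = MvPowerSeries.C (y α) - MvPolynomial.coeToMvPowerSeries.ringHom (linForm b α)
  rw [h, linForm]
  simp only [map_sum, map_mul, MvPolynomial.aeval_C, MvPolynomial.aeval_X,
    MvPolynomial.coeToMvPowerSeries.ringHom_apply, MvPolynomial.coe_C, MvPolynomial.coe_X,
    mul_sub, Finset.sum_sub_distrib, MvPowerSeries.algebraMap_apply, Algebra.algebraMap_self,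
    RingHom.id_apply]

/-- The finite geometric series for `1 / (⟨α, y⟩ - α)`, with its remainder an explicit multiple of
`α ^ N`, as `fracRes_prod` requires. -/
theorem reflect_invR (y : Module.Dual k V) (hy : Regular Δ y) (α : Δ) (N : ℕ) :
    reflect b Δ y hy (invR b Δ α)
      = ∑ j ∈ Finset.range N, ((y α)⁻¹ ^ (j + 1)) • linSeries b (α : V) ^ j
        + linSeries b (α : V) ^ N *
          (MvPowerSeries.C ((y α)⁻¹ ^ N) * reflect b Δ y hy (invR b Δ α)) := by
  set u := reflect b Δ y hy (invR b Δ α) with hu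
  set t := linSeries b (α : V) with ht
  have h1 : u * (MvPowerSeries.C (y α) - t) = 1 := by
    rw [hu, ht, ← reflect_linR b y hy, ← map_mul, invR_mul_linR, map_one]
  have h2 : (MvPowerSeries.C (y α) : MvPowerSeries (Fin r) k) * MvPowerSeries.C (y α)⁻¹ = 1 := by
    rw [← map_mul, mul_inv_cancel₀ (hy α α.2), map_one]
  set c : MvPowerSeries (Fin r) k := MvPowerSeries.C (y α)⁻¹ with hc
  have h3 : ∑ j ∈ Finset.range N, ((y α)⁻¹ ^ (j + 1)) • t ^ j
      = c * ∑ j ∈ Finset.range N, (c * t) ^ j := by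
    rw [Finset.mul_sum]
    refine Finset.sum_congr rfl fun j _ => ?_
    rw [← C_mul_eq_smul, map_pow, ← hc]
    ring
  have h4 := mul_neg_geom_sum (c * t) N
  rw [h3, map_pow, ← hc]
  rw [mul_pow] at h4
  linear_combination (c * ∑ j ∈ Finset.range N, (c * t) ^ j) * h1
    + (- u * ∑ j ∈ Finset.range N, (c * t) ^ j) * h2 - u * h4

theorem cauchyOp_apply (h : IsCompl (G b Δ) (NG b Δ)) (y : Module.Dual k V) (hy : Regular Δ y)
    (φ : RDeltaHat b Δ) (ψ : S b Δ) :
    cauchyOp b Δ h y hy φ ψ = res b Δ h (ofSeries b Δ (reflect b Δ y hy ψ) * φ) := by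
  rw [mul_comm]
  rfl

/-- The image lies in the line of `φ_σ`. The eigenvalue on `φ_σ` is the product of the coefficients
of `α ^ (n_α - 1)` in `1 / (⟨α, y⟩ - α)`, namely `⟨α, y⟩ ^ (-n_α)`. -/
theorem trace_cauchyOp_prod_invR (hΔ₀ : ∀ α ∈ Δ, α ≠ 0) (h : IsCompl (G b Δ) (NG b Δ))
    {σ : Finset Δ} (hσ : IsBasis k σ) {n : Δ → ℕ} (hn : ∀ α ∈ σ, 0 < n α) (y : Module.Dual k V)
    (hy : Regular Δ y) :
    evalAt b Δ y hy (princ b Δ h (toHat b Δ (∏ α ∈ σ, invR b Δ α ^ n α)))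
      = LinearMap.trace k (S b Δ)
        (cauchyOp b Δ h y hy (toHat b Δ (∏ α ∈ σ, invR b Δ α ^ n α))) := by
  have hne : basicS b hσ ≠ 0 := by
    intro h0
    have := congrArg Subtype.val h0
    refine prod_invR_ne_zero b hΔ₀ σ (fun _ => 1) ?_
    simpa [basicS] using this
  have hT : ∀ ψ, cauchyOp b Δ h y hy (toHat b Δ (∏ α ∈ σ, invR b Δ α ^ n α)) ψ
      = fracRes b h σ n (reflect b Δ y hy ψ) := fun ψ => cauchyOp_apply b h y hy _ ψ
  refine (trace_eq_of_forall_mem_span _ hne (fun ψ => ?_) ?_).symm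
  · rw [hT]
    exact fracRes_mem_span b hΔ₀ h hσ hn _
  · rw [hT, show reflect b Δ y hy (basicS b hσ) = ∏ α ∈ σ, reflect b Δ y hy (invR b Δ α) from
        map_prod _ _ _,
      fracRes_prod b hΔ₀ h hσ hn _ _ _ fun α _ => reflect_invR b y hy α (n α),
      princ_toHat_prod_invR b hΔ₀ h hσ hn, map_prod]
    congr 1
    refine Finset.prod_congr rfl fun α hα => ?_
    rw [map_pow, evalAt_invR, Nat.sub_add_cancel (hn α hα)]

/-! ### Exponentials -/

/-- The linear form dual to `α ∈ σ`, where `σ` is a basis of `Δ` (zero for `α ∉ σ`). -/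
def IsBasis.dual {σ : Finset Δ} (hσ : IsBasis k σ) (α : Δ) : Module.Dual k V :=
  open Classical in if hα : α ∈ σ then hσ.basis.coord ⟨α, hα⟩ else 0

theorem IsBasis.dual_self {σ : Finset Δ} (hσ : IsBasis k σ) {α : Δ} (hα : α ∈ σ) :
    hσ.dual α (α : V) = 1 := by
  rw [IsBasis.dual, dif_pos hα]
  conv_lhs => rw [← hσ.basis_apply ⟨α, hα⟩]
  simp

theorem IsBasis.dual_of_ne {σ : Finset Δ} (hσ : IsBasis k σ) {α β : Δ} (hα : α ∈ σ) (hβ : β ∈ σ)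
    (hne : α ≠ β) : hσ.dual α (β : V) = 0 := by
  rw [IsBasis.dual, dif_pos hα]
  conv_lhs => rw [← hσ.basis_apply ⟨β, hβ⟩]
  simp [hne.symm]

theorem IsBasis.sum_dual {σ : Finset Δ} (hσ : IsBasis k σ) (v : V) :
    ∑ α ∈ σ, hσ.dual α v • (α : V) = v := by
  conv_rhs => rw [← hσ.basis.sum_repr v]
  rw [← Finset.sum_coe_sort σ]
  refine Finset.sum_congr rfl fun α _ => ?_
  rw [hσ.basis_apply, IsBasis.dual, dif_pos α.2]
  rfl

theorem exp_eq_sum_add [CharZero k] (N : ℕ) : ∃ q : PowerSeries k,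
    PowerSeries.exp k = ∑ j ∈ Finset.range N, ((j.factorial : k)⁻¹) • PowerSeries.X ^ j
      + PowerSeries.X ^ N * q := by
  have h : PowerSeries.X ^ N ∣ PowerSeries.exp k
      - ∑ j ∈ Finset.range N, ((j.factorial : k)⁻¹) • PowerSeries.X ^ j := by
    rw [PowerSeries.X_pow_dvd_iff]
    intro m hm
    simp [PowerSeries.coeff_exp, PowerSeries.coeff_X_pow, hm]
  obtain ⟨q, hq⟩ := h
  exact ⟨q, by rw [← hq]; ring⟩

/-- The finite form of the exponential series, with remainder divisible by `(-v) ^ N`: a map that is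
merely linear, such as `fracRes`, can be applied to it term by term. -/
theorem expNeg_eq_sum_add [CharZero k] (v : V) (N : ℕ) : ∃ q : MvPowerSeries (Fin r) k,
    expNeg b v = ∑ j ∈ Finset.range N, ((j.factorial : k)⁻¹) • (-linSeries b v) ^ j
      + (-linSeries b v) ^ N * q := by
  obtain ⟨q, hq⟩ := exp_eq_sum_add (k := k) N
  have ha : PowerSeries.HasSubst (-linSeries b v) := by
    apply PowerSeries.HasSubst.of_constantCoeff_zero
    rw [map_neg, neg_eq_zero, ← MvPowerSeries.coeff_zero_eq_constantCoeff_apply, linSeries,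
      MvPolynomial.coeff_coe]
    exact (linForm_isHomogeneous b v).coeff_eq_zero (by simp)
  refine ⟨PowerSeries.substAlgHom ha q, ?_⟩
  change (PowerSeries.exp k).subst (-linSeries b v) = _
  rw [← PowerSeries.coe_substAlgHom ha, hq]
  simp only [map_add, map_sum, map_smul, map_pow, map_mul, PowerSeries.substAlgHom_X]

theorem neg_linSeries_eq_sum {σ : Finset Δ} (hσ : IsBasis k σ) (v : V) :
    -linSeries b v = ∑ α ∈ σ, (-hσ.dual α v) • linSeries b (α : V) := by
  have h : linSeries b v = ∑ α ∈ σ, hσ.dual α v • linSeries b (α : V) := by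
    conv_lhs => rw [← hσ.sum_dual v]
    simp only [linSeries]
    rw [← linFormₗ_apply, map_sum, ← MvPolynomial.coeToMvPowerSeries.ringHom_apply, map_sum]
    refine Finset.sum_congr rfl fun α _ => ?_
    rw [map_smul, MvPolynomial.coeToMvPowerSeries.ringHom_apply, MvPolynomial.coe_smul]
    rfl
  rw [h, ← Finset.sum_neg_distrib]
  exact Finset.sum_congr rfl fun α _ => (neg_smul _ _).symm

theorem neg_linSeries_pow {σ : Finset Δ} (hσ : IsBasis k σ) (v : V) (j : ℕ) [DecidableEq Δ] :
    (-linSeries b v) ^ j = ∑ m ∈ σ.piAntidiag j, ((Nat.multinomial σ m : k)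
      * ∏ α ∈ σ, (-hσ.dual α v) ^ m α) • ∏ α ∈ σ, linSeries b (α : V) ^ m α := by
  rw [neg_linSeries_eq_sum b hσ, Finset.sum_pow_eq_sum_piAntidiag]
  refine Finset.sum_congr rfl fun m _ => ?_
  simp only [smul_pow]
  rw [Finset.prod_smul, mul_smul, Nat.cast_smul_eq_nsmul, nsmul_eq_mul]

/-- Write `v` in the basis `σ`. The monomial `∏ α ^ (n_α - 1)` occurs only in the term of degree `N
= ∑ (n_α - 1)` of the exponential, where the multinomial coefficient over `N!` is `∏ 1 / (n_α -
1)!`. -/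
theorem fracRes_expNeg [CharZero k] (hΔ₀ : ∀ α ∈ Δ, α ≠ 0) (h : IsCompl (G b Δ) (NG b Δ))
    {σ : Finset Δ} (hσ : IsBasis k σ) {n : Δ → ℕ} (hn : ∀ α ∈ σ, 0 < n α) (v : V) :
    fracRes b h σ n (expNeg b v)
      = (∏ α ∈ σ, ((n α - 1).factorial : k)⁻¹ * (-hσ.dual α v) ^ (n α - 1)) • basicS b hσ := by
  classical
  -- The value `0` off `σ` is needed for membership in `σ.piAntidiag`, which constrains the support.
  set m₀ : Δ → ℕ := fun α => if α ∈ σ then n α - 1 else 0 with hm₀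
  set N := ∑ α ∈ σ, (n α - 1) with hN
  have hm₀σ : ∀ α ∈ σ, m₀ α = n α - 1 := fun α hα => by rw [hm₀]; simp only [if_pos hα]
  have hsum : ∑ α ∈ σ, m₀ α = N := Finset.sum_congr rfl hm₀σ
  obtain ⟨q, hq⟩ := expNeg_eq_sum_add b v (N + 1)
  -- Pigeonhole: a monomial of degree `N + 1` has some exponent `m α ≥ n α`, and then contributes
  -- nothing.
  have htail : fracRes b h σ n ((-linSeries b v) ^ (N + 1) * q) = 0 := by
    rw [neg_linSeries_pow b hσ, Finset.sum_mul, map_sum]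
    refine Finset.sum_eq_zero fun m hm => ?_
    obtain ⟨α, hα, hle⟩ : ∃ α ∈ σ, n α ≤ m α := by
      by_contra! hlt
      have h1 : ∑ α ∈ σ, m α ≤ N := Finset.sum_le_sum fun α hα => by
        have := hlt α hα
        omega
      have h2 : ∑ α ∈ σ, m α = N + 1 := (Finset.mem_piAntidiag.1 hm).1
      omega
    rw [smul_mul_assoc, map_smul,
      ← Finset.mul_prod_erase σ (fun α => linSeries b (α : V) ^ m α) hα, mul_assoc,
      fracRes_linSeries_pow_mul b h hσ hα hle, smul_zero]
  have hpow : ∀ j, fracRes b h σ n ((-linSeries b v) ^ j)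
      = if j = N then ((Nat.multinomial σ m₀ : k) * ∏ α ∈ σ, (-hσ.dual α v) ^ (n α - 1))
          • basicS b hσ else 0 := by
    intro j
    rw [neg_linSeries_pow b hσ, map_sum]
    simp only [map_smul, fracRes_prod_linSeries_pow b hΔ₀ h hσ]
    have hmatch : ∀ m ∈ σ.piAntidiag j, (∀ α ∈ σ, n α = m α + 1) → j = N ∧ m = m₀ := by
      intro m hm hnm
      obtain ⟨h1, h2⟩ := Finset.mem_piAntidiag.1 hm
      have h3 : m = m₀ := by
        funext α
        by_cases hα : α ∈ σ
        · rw [hm₀σ α hα, hnm α hα, Nat.add_sub_cancel]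
        · rw [hm₀]
          simp only [if_neg hα]
          by_contra h0
          exact hα (h2 α h0)
      exact ⟨by rw [← h1, h3, hsum], h3⟩
    split_ifs with hj
    · subst hj
      rw [Finset.sum_eq_single m₀]
      · rw [if_pos fun α hα => by rw [hm₀σ α hα, Nat.sub_add_cancel (hn α hα)]]
        congr 2
        exact Finset.prod_congr rfl fun α hα => by rw [hm₀σ α hα]
      · intro m hm hne
        rw [if_neg fun hnm => hne (hmatch m hm hnm).2, smul_zero]
      · intro hm
        refine absurd (Finset.mem_piAntidiag.2 ⟨hsum, fun α h0 => ?_⟩) hm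
        by_contra hα
        exact h0 (by rw [hm₀]; simp only [if_neg hα])
    · refine Finset.sum_eq_zero fun m hm => ?_
      rw [if_neg fun hnm => hj (hmatch m hm hnm).1, smul_zero]
  rw [hq, map_add, htail, add_zero, map_sum]
  simp only [map_smul, hpow, smul_ite, smul_zero]
  rw [Finset.sum_ite_eq' (Finset.range (N + 1)) N, if_pos (Finset.self_mem_range_succ N), smul_smul]
  congr 1
  have hspec : (∏ α ∈ σ, ((n α - 1).factorial : k)) * (Nat.multinomial σ m₀ : k)
      = (N.factorial : k) := by
    have := Nat.multinomial_spec σ m₀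
    rw [hsum] at this
    rw [← this, Nat.cast_mul, Nat.cast_prod]
    congr 1
    exact Finset.prod_congr rfl fun α hα => by rw [hm₀σ α hα]
  have hN0 : (N.factorial : k) ≠ 0 := Nat.cast_ne_zero.2 (Nat.factorial_ne_zero N)
  have hP0 : (∏ α ∈ σ, ((n α - 1).factorial : k)) ≠ 0 :=
    Finset.prod_ne_zero_iff.2 fun α _ => Nat.cast_ne_zero.2 (Nat.factorial_ne_zero _)
  rw [Finset.prod_mul_distrib, Finset.prod_inv_distrib, ← mul_assoc]
  congr 1
  rw [← hspec] at hN0 ⊢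
  field_simp
  exact div_self (right_ne_zero_of_mul hN0)

/-! ### Differential operators on basic fractions -/

/-- The direction dual to `α` annihilates the other elements of `σ`, so only `α⁻¹` is
differentiated; its `l`-th derivative is `(-1) ^ l l! α ^ (-(l + 1))`. -/
theorem diffHom_dualForm_pow_prod_invR {σ : Finset Δ} (hσ : IsBasis k σ) {α : Δ} (hα : α ∈ σ)
    [DecidableEq Δ] (m : Δ → ℕ) (hm : m α = 1) (l : ℕ) :
    diffHom b Δ (dualForm b (hσ.dual α) ^ l) (∏ β ∈ σ, invR b Δ β ^ m β)
      = ((-1) ^ l * (l.factorial : k)) •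
        ∏ β ∈ σ, invR b Δ β ^ Function.update m α (l + 1) β := by
  induction l with
  | zero =>
    rw [pow_zero, map_one, Module.End.one_apply, zero_add, ← hm, Function.update_eq_self, pow_zero,
      Nat.factorial_zero, Nat.cast_one, mul_one, one_smul]
  | succ l ih =>
    rw [pow_succ', map_mul, Module.End.mul_apply, ih, map_smul, diffHom_dualForm,
      dirDeriv_prod_invR, Finset.sum_eq_single α]
    · rw [invR_mul_prod_invR b Δ hα, Function.update_self, Function.update_idem, hσ.dual_self hα,
        smul_smul]
      congr 1
      rw [Nat.factorial_succ]
      push_cast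
      ring
    · intro β hβ hne
      rw [hσ.dual_of_ne hα hβ hne.symm, mul_zero, neg_zero, zero_smul]
    · exact fun h => absurd hα h

/-- The polynomial `∏_{α ∈ σ} (-α^*) ^ (n_α - 1) / (n_α - 1)!` on `V`. -/
def fracPoly {σ : Finset Δ} (hσ : IsBasis k σ) (n : Δ → ℕ) : MvPolynomial (Fin r) k :=
  ∏ α ∈ σ, (((n α - 1).factorial : k)⁻¹ * (-1) ^ (n α - 1)) •
    dualForm b (hσ.dual α) ^ (n α - 1)

theorem eval_fracPoly {σ : Finset Δ} (hσ : IsBasis k σ) (n : Δ → ℕ) (v : V) :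
    MvPolynomial.eval (b.repr v) (fracPoly b hσ n)
      = ∏ α ∈ σ, ((n α - 1).factorial : k)⁻¹ * (-hσ.dual α v) ^ (n α - 1) := by
  rw [fracPoly, map_prod]
  refine Finset.prod_congr rfl fun α _ => ?_
  rw [MvPolynomial.smul_eval, map_pow, eval_dualForm, neg_pow (hσ.dual α v), mul_assoc]

/-- The signs and factorials in `fracPoly` cancel those produced by differentiating the factors
`α⁻¹`. -/
theorem diffHom_fracPoly [CharZero k] {σ : Finset Δ} (hσ : IsBasis k σ) {n : Δ → ℕ}
    (hn : ∀ α ∈ σ, 0 < n α) :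
    diffHom b Δ (fracPoly b hσ n) (basicS b hσ) = ∏ α ∈ σ, invR b Δ α ^ n α := by
  classical
  -- The elements of `s` have already been raised to their final exponent; the others still have
  -- exponent `1`, as the previous lemma demands.
  have key : ∀ s ⊆ σ, diffHom b Δ (∏ α ∈ s, (((n α - 1).factorial : k)⁻¹ * (-1) ^ (n α - 1)) •
      dualForm b (hσ.dual α) ^ (n α - 1)) (basicS b hσ)
        = ∏ β ∈ σ, invR b Δ β ^ (if β ∈ s then n β else 1) := by
    intro s
    induction s using Finset.induction_on with
    | empty => intro _; simp [basicS]
    | insert α s hα ih =>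
      intro hs
      have hασ := hs (Finset.mem_insert_self α s)
      rw [Finset.prod_insert hα, map_mul, Module.End.mul_apply,
        ih ((Finset.subset_insert α s).trans hs), map_smul, LinearMap.smul_apply,
        diffHom_dualForm_pow_prod_invR b hσ hασ _ (if_neg hα), smul_smul]
      have h1 : ((n α - 1).factorial : k)⁻¹ * (-1) ^ (n α - 1)
          * ((-1) ^ (n α - 1) * ((n α - 1).factorial : k)) = 1 := by
        have h2 : ((n α - 1).factorial : k) ≠ 0 := Nat.cast_ne_zero.2 (Nat.factorial_ne_zero _)
        have h3 : ((-1 : k) ^ (n α - 1)) * (-1) ^ (n α - 1) = 1 := by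
          rw [← mul_pow, neg_one_mul, neg_neg, one_pow]
        field_simp
        rw [pow_two, h3]
      rw [h1, one_smul]
      refine Finset.prod_congr rfl fun β _ => ?_
      rcases eq_or_ne β α with rfl | hne
      · rw [Function.update_self, if_pos (Finset.mem_insert_self β s),
          Nat.sub_add_cancel (hn β hασ)]
      · rw [Function.update_of_ne hne]
        congr 1
        simp [hne]
  rw [fracPoly, key σ subset_rfl]
  exact Finset.prod_congr rfl fun β hβ => by rw [if_pos hβ]

/-! ### The main theorem -/

/-- For `φ = f / d`, take the truncation of `f` over `d`; the tail starts beyond degree `K` and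
stays there after multiplication by any `p`. -/
theorem exists_toHat_add (K : ℤ) (φ : RDeltaHat b Δ) :
    ∃ (x : RDelta b Δ) (φ' : RDeltaHat b Δ), φ = toHat b Δ x + φ' ∧
      ∀ p, taylor b Δ K (ofSeries b Δ p * φ') = 0 := by
  obtain ⟨⟨f, d⟩, hf⟩ := exists_rep b Δ φ
  simp only at hf
  set M := (K + ((d : MvPolynomial (Fin r) k).totalDegree : ℤ) + 1).toNat with hM
  set g := MvPowerSeries.truncTotal M f with hg
  refine ⟨Localization.mk g d, φ - toHat b Δ (Localization.mk g d), by ring, fun p => ?_⟩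
  refine taylor_mul_eq_zero K _ p (f - (g : MvPowerSeries (Fin r) k)) d ?_ ?_
  · rw [sub_mul, hf, map_sub]
    congr 1
    rw [← toHat_algebraMap, ← toHat_algebraMap, ← map_mul, Localization.mk_eq_mk',
      IsLocalization.mk'_spec]
  · ext m
    rw [← hM, MvPowerSeries.coeff_truncTotal_eq_ite, map_sub, MvPolynomial.coeff_coe, hg,
      MvPowerSeries.coeff_truncTotal_eq_ite]
    split_ifs <;> simp

/-- The reduction to basic fractions. The case `negl` covers both Taylor tails and elements of `NG`;
its quantifier over `p` is there because the two assertions involve `φ` multiplied by Taylor series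
of reflected functions and by exponentials. -/
theorem RDeltaHat_induction (h : IsCompl (G b Δ) (NG b Δ)) {motive : RDeltaHat b Δ → Prop}
    (negl : ∀ φ, (∀ p, princ b Δ h (ofSeries b Δ p * φ) = 0) → motive φ)
    (frac : ∀ (σ : Finset Δ) (n : Δ → ℕ), IsBasis k σ → (∀ α ∈ σ, 0 < n α) →
      motive (toHat b Δ (∏ α ∈ σ, invR b Δ α ^ n α)))
    (add : ∀ φ ψ, motive φ → motive ψ → motive (φ + ψ))
    (smul : ∀ (c : k) φ, motive φ → motive (c • φ)) (φ : RDeltaHat b Δ) : motive φ := by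
  obtain ⟨x, φ', rfl, hφ'⟩ := exists_toHat_add b (-r) φ
  refine add _ _ ?_ (negl _ fun p => by rw [princ, LinearMap.comp_apply, hφ' p, map_zero])
  have hx : x ∈ NG b Δ ⊔ basicFractions b Δ Set.univ := by rw [NG_sup_basicFractions]; trivial
  obtain ⟨y, hy, z, hz, rfl⟩ := Submodule.mem_sup.1 hx
  rw [map_add]
  refine add _ _ (negl _ fun p => princ_ofSeries_mul_toHat_eq_zero h p hy) ?_
  clear hx
  unfold basicFractions at hz
  induction hz using Submodule.span_induction with
  | zero => exact negl _ fun p => by rw [map_zero, mul_zero, map_zero]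
  | add x y _ _ hx hy => rw [map_add]; exact add _ _ hx hy
  | smul c x _ hx => rw [map_smul]; exact smul c _ hx
  | mem x hx =>
    obtain ⟨σ, -, n, hσ, hn, rfl⟩ := hx
    exact frac σ n hσ hn

theorem cauchyOp_add (h : IsCompl (G b Δ) (NG b Δ)) (y : Module.Dual k V) (hy : Regular Δ y)
    (φ ψ : RDeltaHat b Δ) :
    cauchyOp b Δ h y hy (φ + ψ) = cauchyOp b Δ h y hy φ + cauchyOp b Δ h y hy ψ := by
  ext1 x
  rw [LinearMap.add_apply, cauchyOp_apply, cauchyOp_apply, cauchyOp_apply, mul_add, map_add]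

theorem cauchyOp_smul (h : IsCompl (G b Δ) (NG b Δ)) (y : Module.Dual k V) (hy : Regular Δ y)
    (c : k) (φ : RDeltaHat b Δ) :
    cauchyOp b Δ h y hy (c • φ) = c • cauchyOp b Δ h y hy φ := by
  ext1 x
  rw [LinearMap.smul_apply, cauchyOp_apply, cauchyOp_apply, mul_smul_comm, map_smul]

/-- The values of `Princ_Δ φ` are traces of endomorphisms of `S_Δ`. -/
theorem evalAt_princ (hΔ₀ : ∀ α ∈ Δ, α ≠ 0) (h : IsCompl (G b Δ) (NG b Δ))
    (φ : RDeltaHat b Δ) (y : Module.Dual k V) (hy : Regular Δ y) :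
    evalAt b Δ y hy (princ b Δ h φ) = LinearMap.trace k (S b Δ) (cauchyOp b Δ h y hy φ) := by
  induction φ using RDeltaHat_induction b h with
  | negl φ hφ =>
    have h1 := hφ 1
    rw [map_one, one_mul] at h1
    have h2 : cauchyOp b Δ h y hy φ = 0 := by
      ext1 x
      rw [cauchyOp_apply, res, LinearMap.comp_apply, hφ, map_zero, LinearMap.zero_apply]
    rw [h1, h2, map_zero]
    exact map_zero _
  | frac σ n hσ hn => exact trace_cauchyOp_prod_invR b hΔ₀ h hσ hn y hy
  | add φ ψ hφ hψ =>
    rw [cauchyOp_add, map_add, map_add, ← hφ, ← hψ]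
    exact map_add _ _ _
  | smul c φ hφ =>
    rw [cauchyOp_smul, map_smul, map_smul, ← hφ]
    exact map_smul _ _ _

/-- `Princ_Δ φ` is obtained from `S_Δ` by differential operators with constant coefficients. -/
theorem exists_diffOp_eq_princ [CharZero k] (hΔ₀ : ∀ α ∈ Δ, α ≠ 0)
    (h : IsCompl (G b Δ) (NG b Δ)) (φ : RDeltaHat b Δ) {B : Type*} [Fintype B]
    (β : Module.Basis B k (S b Δ)) :
    ∃ D : B → MvPolynomial (Fin r) k,
      (∀ (c : B) (v : V), MvPolynomial.eval (b.repr v) (D c)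
        = β.coord c (res b Δ h (algebraMap _ _ (expNeg b v) * φ))) ∧
      (princ b Δ h φ : RDelta b Δ) = ∑ c, diffOp b Δ (D c) (β c : RDelta b Δ) := by
  simp only [diffOp_eq, ← ofSeries_apply]
  induction φ using RDeltaHat_induction b h with
  | negl φ hφ =>
    have h1 := hφ 1
    rw [map_one, one_mul] at h1
    refine ⟨0, fun c v => ?_, ?_⟩
    · rw [res, LinearMap.comp_apply, hφ, map_zero, map_zero, Pi.zero_apply, map_zero]
    · simp [h1]
  | frac σ n hσ hn =>
    -- The residue of `e^{-v} φ` is a scalar multiple of `φ_σ`, so every `D c` is the same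
    -- polynomial scaled by a coordinate of `φ_σ`; summing over `c` reassembles `φ_σ`.
    refine ⟨fun c => β.coord c (basicS b hσ) • fracPoly b hσ n, fun c v => ?_, ?_⟩
    · rw [MvPolynomial.smul_eval, eval_fracPoly, ← fracRes_apply,
        fracRes_expNeg b hΔ₀ h hσ hn, map_smul, smul_eq_mul, mul_comm]
    · rw [princ_toHat_prod_invR b hΔ₀ h hσ hn, ← diffHom_fracPoly b hσ hn]
      have h1 : (basicS b hσ : RDelta b Δ)
          = ∑ c, β.coord c (basicS b hσ) • (β c : RDelta b Δ) := by
        have := congrArg (S b Δ).subtype (β.sum_repr (basicS b hσ))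
        rw [map_sum] at this
        exact this.symm
      conv_lhs => rw [h1]
      rw [map_sum]
      exact Finset.sum_congr rfl fun c _ => by rw [map_smul, map_smul, LinearMap.smul_apply]
  | add φ ψ hφ hψ =>
    obtain ⟨D, h1, h2⟩ := hφ
    obtain ⟨E, h3, h4⟩ := hψ
    refine ⟨D + E, fun c v => ?_, ?_⟩
    · rw [Pi.add_apply, map_add, h1, h3, mul_add, map_add, map_add]
    · rw [map_add, Submodule.coe_add, h2, h4, ← Finset.sum_add_distrib]
      exact Finset.sum_congr rfl fun c _ => by rw [Pi.add_apply, map_add, LinearMap.add_apply]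
  | smul a φ hφ =>
    obtain ⟨D, h1, h2⟩ := hφ
    refine ⟨a • D, fun c v => ?_, ?_⟩
    · rw [Pi.smul_apply, MvPolynomial.smul_eval, h1, mul_smul_comm, map_smul, map_smul, smul_eq_mul]
    · rw [map_smul, Submodule.coe_smul, h2, Finset.smul_sum]
      exact Finset.sum_congr rfl fun c _ => by rw [Pi.smul_apply, map_smul, LinearMap.smul_apply]

end JK
end

/-- The existential over `D` loses nothing: `k` is infinite, so the prescribed values determine each
polynomial `D c`. -/
theorem mainTheorem3 {k : Type*} [Field k] [CharZero k] {V : Type*} [AddCommGroup V] [Module k V]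
    {r : ℕ} (b : Module.Basis (Fin r) k V) (Δ : Finset V) (hΔ₀ : ∀ α ∈ Δ, α ≠ 0)
    (hΔ : Submodule.span k (Δ : Set V) = ⊤) :
    ∃ hGN : IsCompl (JK.G b Δ) (JK.NG b Δ),
      (∀ (φ : JK.RDeltaHat b Δ) (y : Module.Dual k V) (hy : JK.Regular Δ y),
        JK.evalAt b Δ y hy (JK.princ b Δ hGN φ)
          = LinearMap.trace k (JK.S b Δ) (JK.cauchyOp b Δ hGN y hy φ)) ∧
      (∀ (φ : JK.RDeltaHat b Δ) {B : Type*} [Fintype B] (β : Module.Basis B k (JK.S b Δ)),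
        ∃ D : B → MvPolynomial (Fin r) k,
          (∀ (c : B) (h : V), MvPolynomial.eval (b.repr h) (D c)
            = β.coord c (JK.res b Δ hGN (algebraMap _ _ (JK.expNeg b h) * φ))) ∧
          (JK.princ b Δ hGN φ : JK.RDelta b Δ)
            = ∑ c, JK.diffOp b Δ (D c) (β c : JK.RDelta b Δ)) :=
  ⟨JK.isCompl_G_NG b hΔ₀, JK.evalAt_princ b hΔ₀ _,
    fun φ _ _ β => JK.exists_diffOp_eq_princ b hΔ₀ _ φ β⟩
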